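/- Let $K_{\max}\ge 2$ and $n\ge K_{\max}$ be integers, let $p$ be a probability distribution on $\{1,\dots,K_{\max}\}$, and for each $d$ let $\mathcal T_d$ be a probability distribution on the Boolean functions $\{-1,+1\}^d\to\{-1,+1\}$. A random Boolean network $\mathcal N$ on the nodes $1,\dots,n$ is generated as follows, independently for each node $v$: draw an indegree $d$ from $p$; choose a uniformly random $d$-element set of nodes (drawn without replacement from all $n$ nodes, $v$ itself allowed) as the in-neighbourhood of $v$; draw a transfer function $\tau_v$ from $\mathcal T_d$, whose $j$-th input is the state of the $j$-th in-neighbour in increasing order of labels. All nodes update in parallel: the state of $v$ at time $t+1$ is $\tau_v$ applied to the states of its in-neighbours at time $t$. Assume that the transfer functions satisfy one of the following two conditions. - Full independence: for every $d$ with $p(d)>0$, the $2^d$ entries of the truth table of a random function drawn from $\mathcal T_d$ are independent and identically distributed. - Balance on average: if $d$ is drawn from $p$, then $f$ from $\mathcal T_d$, and then $x$ uniformly from $\{-1,+1\}^d$, then $\Pr[f(x)=+1]=1/2$. For $f:\{-1,+1\}^d\to\{-1,+1\}$ let $\mathrm{Inf}_i(f)=\Pr_x[f(x)\ne f(x^{(i)})]$,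 where $x$ is uniformly random and $x^{(i)}$ is $x$ with its $i$-th bit flipped. Put $I(d)=\mathbb E_{f\sim\mathcal T_d}\big[\sum_{i=1}^d \mathrm{Inf}_i(f)\big]$ and $\mathcal I=\sum_{d=1}^{K_{\max}}p(d)\,I(d)$. Run $\mathcal N$ from a uniformly random state $x\in\{-1,+1\}^n$ and from $x^{(i)}$ with a uniformly random $i\in\{1,\dots,n\}$, where $x$, $i$ and $\mathcal N$ are independent, and let $\Delta_t$ be the Hamming distance of the two states at time $t$. Then for every integer $t$ with $0\le t\le t^*=\dfrac{\log n}{4\log K_{\max}}$, $$\big|\,\mathbb E[\Delta_t]-\mathcal I^{\,t}\,\big|\le \frac1{n^{1/4}},$$ where the expectation is over $\mathcal N$, $x$ and $i$. -/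

import Mathlib

open scoped BigOperators

namespace RBN

noncomputable section

/-- A bit; `true` stands for `+1` and `false` for `-1`. `BoolFun d` is the type of Boolean functions
of `d` input bits. -/
abbrev BoolFun (d : ℕ) : Type := (Fin d → Bool) → Bool

/-- The point `x` with its `i`-th bit flipped. -/
def flip {d : ℕ} (x : Fin d → Bool) (i : Fin d) : Fin d → Bool :=
  Function.update x i (!(x i))

/-- The influence of input `i` on `f`: the probability, over a uniformly random input `x`, that
flipping bit `i` of `x` changes the value of `f`. -/
def influence {d : ℕ} (f : BoolFun d) (i : Fin d) : ℝ :=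
  𝔼 x : Fin d → Bool, if f x ≠ f (flip x i) then (1 : ℝ) else 0

/-- The expectation of a real function on a finite type under a probability mass function. -/
def expectation {α : Type*} [Fintype α] (P : PMF α) (g : α → ℝ) : ℝ :=
  ∑ a, (P a).toReal * g a

/-- The expected total influence `I(d)` of a distribution on `d`-input functions. -/
def expInfluence {d : ℕ} (P : PMF (BoolFun d)) : ℝ :=
  expectation P fun f => ∑ i, influence f i

/-- The parameter `∑_{d = 1}^{Kmax} p(d) I(d)`. -/
def networkInfluence (Kmax : ℕ) (D : PMF ℕ) (T : (d : ℕ) → PMF (BoolFun d)) : ℝ :=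
  ∑ d ∈ Finset.Icc 1 Kmax, (D d).toReal * expInfluence (T d)

/-- Full independence: for every possible indegree `d`, the entries of the truth table of a random
`d`-input transfer function are independent and identically distributed. -/
def FullyIndependent (D : PMF ℕ) (T : (d : ℕ) → PMF (BoolFun d)) : Prop :=
  ∀ d ∈ D.support, ∃ q : PMF Bool, ∀ f : BoolFun d, T d f = ∏ x, q (f x)

/-- The law of the output `f(x)` of a random transfer function `f` (its number `d` of inputs is drawn
from `D`, and then `f` from `T d`) at a uniformly random input `x`. -/
def outputLaw (D : PMF ℕ) (T : (d : ℕ) → PMF (BoolFun d)) : PMF Bool :=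
  D.bind fun d => (T d).bind fun f => (PMF.uniformOfFintype (Fin d → Bool)).map f

/-- Balance on average: `Pr_{f,x}[f(x) = +1] = 1/2`. -/
def BalancedOnAverage (D : PMF ℕ) (T : (d : ℕ) → PMF (BoolFun d)) : Prop :=
  outputLaw D T true = 1 / 2

/-- What a Boolean network on `n` nodes specifies at one node: the set of in-neighbours, and a
transfer function with one input for each in-neighbour. -/
abbrev NodeRule (n : ℕ) : Type := (S : Finset (Fin n)) × BoolFun S.card

/-- A Boolean network on `n` nodes. -/
abbrev Network (n : ℕ) : Type := Fin n → NodeRule n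

/-- One parallel update. Input `j` of the transfer function of node `v` is the state of the `j`-th
in-neighbour of `v`, in increasing order of labels. -/
def step {n : ℕ} (N : Network n) (x : Fin n → Bool) : Fin n → Bool :=
  fun v => (N v).2 fun j => x ((N v).1.orderEmbOfFin rfl j)

/-- The state after `t` parallel updates from the state `x`. -/
def stateAt {n : ℕ} (N : Network n) (t : ℕ) (x : Fin n → Bool) : Fin n → Bool :=
  (step N)^[t] x

/-- The expected Hamming distance at time `t` between the trajectories of `N` that start at a
uniformly random state `x` and at its perturbation in a uniformly random bit `i`. -/
def avgInfluence {n : ℕ} (N : Network n) (t : ℕ) : ℝ :=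
  𝔼 i : Fin n, 𝔼 x : Fin n → Bool,
    (hammingDist (stateAt N t x) (stateAt N t (flip x i)) : ℝ)

theorem powersetCard_nonempty {n d : ℕ} (h : d ≤ n) :
    (Finset.powersetCard d (Finset.univ : Finset (Fin n))).Nonempty := by
  rw [Finset.powersetCard_nonempty]
  simpa using h

/-- The law of the rule of one node: the indegree `d` is drawn from `D`, then the set of
in-neighbours uniformly among the `d`-element sets of nodes, then the transfer function from
`T d`. -/
def randomRule (n : ℕ) (D : PMF ℕ) (T : (d : ℕ) → PMF (BoolFun d))
    (hD : ∀ d ∈ D.support, d ≤ n) : PMF (NodeRule n) :=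
  D.bindOnSupport fun d hd =>
    (PMF.uniformOfFinset (Finset.powersetCard d (Finset.univ : Finset (Fin n)))
      (powersetCard_nonempty (hD d hd))).bind fun S =>
        (T S.card).map fun f => (⟨S, f⟩ : NodeRule n)

/-- The law of a finite family of independent random elements with common law `P`. -/
def iidLaw {ι α : Type*} [Fintype ι] [DecidableEq ι] [Fintype α] (P : PMF α) : PMF (ι → α) :=
  PMF.ofFintype (fun a => ∏ i, P (a i)) <| by
    have h : ∑ b, P b = 1 := by rw [← tsum_fintype (L := .unconditional _)]; exact P.tsum_coe
    rw [← Fintype.piFinset_univ, ← Finset.prod_univ_sum]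
    simp [h]

/-- The law of the random Boolean network: the rules of the nodes are independent. -/
def randomNetwork (n : ℕ) (D : PMF ℕ) (T : (d : ℕ) → PMF (BoolFun d))
    (hD : ∀ d ∈ D.support, d ≤ n) : PMF (Network n) :=
  iidLaw (randomRule n D T hD)

end

end RBN

/-! Exchanging the roles of the perturbed bit and the observed node turns the expected distance into
the average over nodes `a` of the expected number of initial bits whose flip changes the state of
`a` at time `t` (`expectation_avgInfluence`). That state is the value of the depth-`t` tree of
in-neighbours below `a`, whose labels are looked up in the network (`treeValue_place`).

If every tree node carried a fresh independent label instead, the expected sensitivity would be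
exactly the `t`-th power of the network influence (`mean_sensitivity`). A flip at a leaf reaches the
root iff it reaches a child and the root rule is pivotal in that input (`sensitivity_succ`).
Pivotality of input `j` depends only on the root rule and the other subtrees, so for a given root
rule the two factors are independent. The expected number of pivotal inputs is the network influence
(`mean_pivotal`): under full independence because every fixed input vector gives the same mean,
under balance because the inputs are then uniform.

The two models agree on the event that the reached tree nodes stand for distinct places
(`mean_exploration`, `networkSensitivity_eq`). Counting coincident pairs bounds the probability of
the complement by `K ^ (2 t) / n` (`mean_collisions_le`, `mean_not_injOn_le`). There both
sensitivities lie between `0` and `K ^ t`, so the means differ by at most `K ^ (3 t) / n`, and the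
restriction on `t` says `K ^ t ≤ n ^ (1/4)`. -/

namespace RBN

noncomputable section

/-! ### Means over independent families on finite types. -/

/-- A probability weight on a finite type. -/
structure IsWeight {α : Type*} [Fintype α] (w : α → ℝ) : Prop where
  nonneg : ∀ a, 0 ≤ w a
  sum_eq_one : ∑ a, w a = 1

/-- The mean of `F` under the weight `w`. -/
def mean {α : Type*} [Fintype α] (w F : α → ℝ) : ℝ := ∑ a, w a * F a

/-- The weight of a family of independent elements with common weight `w`. -/
def prodWeight {α : Type*} (ι : Type*) [Fintype ι] (w : α → ℝ) : (ι → α) → ℝ :=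
  fun a => ∏ i, w (a i)

section Mean

variable {α : Type*} [Fintype α] {w : α → ℝ}

theorem mean_add (w F G : α → ℝ) : mean w (fun a => F a + G a) = mean w F + mean w G := by
  simp [mean, mul_add, Finset.sum_add_distrib]

theorem mean_sub (w F G : α → ℝ) : mean w (fun a => F a - G a) = mean w F - mean w G := by
  simp [mean, mul_sub, Finset.sum_sub_distrib]

theorem mean_sum {κ : Type*} (w : α → ℝ) (s : Finset κ) (F : κ → α → ℝ) :
    mean w (fun a => ∑ k ∈ s, F k a) = ∑ k ∈ s, mean w (F k) := by
  simp only [mean, Finset.mul_sum]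
  exact Finset.sum_comm

theorem mean_mul_left (w F : α → ℝ) (c : ℝ) : mean w (fun a => c * F a) = c * mean w F := by
  simp only [mean, Finset.mul_sum]
  exact Finset.sum_congr rfl fun a _ => by ring

theorem mean_mul_right (w F : α → ℝ) (c : ℝ) : mean w (fun a => F a * c) = mean w F * c := by
  simp only [mean, Finset.sum_mul]
  exact Finset.sum_congr rfl fun a _ => by ring

theorem mean_comm {β : Type*} [Fintype β] (w : α → ℝ) (v : β → ℝ) (F : α → β → ℝ) :
    mean w (fun a => mean v (F a)) = mean v (fun b => mean w fun a => F a b) := by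
  simp only [mean, Finset.mul_sum]
  rw [Finset.sum_comm]
  exact Finset.sum_congr rfl fun a _ => Finset.sum_congr rfl fun b _ => by ring

theorem IsWeight.mean_const (hw : IsWeight w) (c : ℝ) : mean w (fun _ => c) = c := by
  simp [mean, ← Finset.sum_mul, hw.sum_eq_one]

theorem IsWeight.mean_mono (hw : IsWeight w) {F G : α → ℝ}
    (h : ∀ a, w a ≠ 0 → F a ≤ G a) : mean w F ≤ mean w G := by
  refine Finset.sum_le_sum fun a _ => ?_
  by_cases ha : w a = 0
  · simp [ha]
  · exact mul_le_mul_of_nonneg_left (h a ha) (hw.nonneg a)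

theorem IsWeight.mean_nonneg (hw : IsWeight w) {F : α → ℝ} (h : ∀ a, 0 ≤ F a) : 0 ≤ mean w F :=
  Finset.sum_nonneg fun a _ => mul_nonneg (hw.nonneg a) (h a)

theorem isWeight_prodWeight {ι : Type*} [Fintype ι] [DecidableEq ι] (hw : IsWeight w) :
    IsWeight (prodWeight ι w) where
  nonneg a := Finset.prod_nonneg fun i _ => hw.nonneg _
  sum_eq_one := by
    unfold prodWeight
    rw [← Fintype.piFinset_univ, ← Finset.prod_univ_sum]
    simp [hw.sum_eq_one]

omit [Fintype α] in
theorem prodWeight_ne_zero {ι : Type*} [Fintype ι] {a : ι → α} (h : prodWeight ι w a ≠ 0) (i : ι) :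
    w (a i) ≠ 0 :=
  fun hi => h (Finset.prod_eq_zero (Finset.mem_univ i) hi)

omit [Fintype α] in
-- Exchanging the coordinate `j` with an independent copy preserves the joint weight. The product
-- form avoids dividing by `w (a j)`, which may vanish.
theorem prodWeight_update {ι : Type*} [Fintype ι] [DecidableEq ι] (a : ι → α) (j : ι) (x : α) :
    prodWeight ι w (Function.update a j x) * w (a j) = prodWeight ι w a * w x := by
  unfold prodWeight
  rw [← Finset.mul_prod_erase Finset.univ _ (Finset.mem_univ j),
    ← Finset.mul_prod_erase Finset.univ (fun i => w (a i)) (Finset.mem_univ j),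
    Finset.prod_congr rfl fun i hi => by
      rw [Function.update_of_ne (Finset.ne_of_mem_erase hi)]]
  simp
  ring

/-- Resampling one coordinate of an independent family does not change the mean. -/
theorem mean_prodWeight_resample {ι : Type*} [Fintype ι] [DecidableEq ι] (hw : IsWeight w)
    (j : ι) (F : (ι → α) → ℝ) :
    mean (prodWeight ι w) F
      = mean (prodWeight ι w) fun a => mean w fun x => F (Function.update a j x) := by
  -- The involution that exchanges coordinate `j` with the fresh sample.
  let e : (ι → α) × α ≃ (ι → α) × α :=
    { toFun := fun q => (Function.update q.1 j q.2, q.1 j)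
      invFun := fun q => (Function.update q.1 j q.2, q.1 j)
      left_inv := fun q => by simp
      right_inv := fun q => by simp }
  have h : mean (prodWeight ι w) (fun a => mean w fun x => F (Function.update a j x))
      = ∑ q : (ι → α) × α, prodWeight ι w q.1 * w q.2 * F (Function.update q.1 j q.2) := by
    rw [Fintype.sum_prod_type]
    simp only [mean, Finset.mul_sum, mul_assoc]
  rw [h, ← Equiv.sum_comp e, Fintype.sum_prod_type]
  refine Finset.sum_congr rfl fun a _ => ?_
  simp only [e, Equiv.coe_fn_mk, prodWeight_update]
  simp [← Finset.sum_mul, ← Finset.mul_sum, hw.sum_eq_one]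

/-- A function of the coordinate `j` is independent of a function of the other coordinates. -/
theorem mean_prodWeight_mul {ι : Type*} [Fintype ι] [DecidableEq ι] (hw : IsWeight w)
    (j : ι) (F : (ι → α) → ℝ) (hF : ∀ a x, F (Function.update a j x) = F a) (G : α → ℝ) :
    mean (prodWeight ι w) (fun a => F a * G (a j)) = mean (prodWeight ι w) F * mean w G := by
  rw [mean_prodWeight_resample hw j]
  simp [hF, mean_mul_left, mean_mul_right]

theorem mean_prodWeight_apply {ι : Type*} [Fintype ι] [DecidableEq ι] (hw : IsWeight w)
    (j : ι) (G : α → ℝ) :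
    mean (prodWeight ι w) (fun a => G (a j)) = mean w G := by
  have h := mean_prodWeight_mul hw j (fun _ => 1) (fun _ _ => rfl) G
  simpa [(isWeight_prodWeight hw).mean_const] using h

theorem mean_prodWeight_apply_mul {ι : Type*} [Fintype ι] [DecidableEq ι] (hw : IsWeight w)
    {i j : ι} (hij : i ≠ j) (F G : α → ℝ) :
    mean (prodWeight ι w) (fun a => F (a i) * G (a j)) = mean w F * mean w G := by
  rw [mean_prodWeight_mul hw j (fun a => F (a i)) (fun a x => by
    rw [Function.update_of_ne hij]), mean_prodWeight_apply hw]

theorem mean_equiv {β : Type*} [Fintype β] (e : β ≃ α) (w F : α → ℝ) :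
    mean w F = mean (w ∘ e) (F ∘ e) :=
  (Equiv.sum_comp e fun a => w a * F a).symm

theorem mean_prod {β : Type*} [Fintype β] (w : α → ℝ) (v : β → ℝ) (F : α × β → ℝ) :
    mean (fun q => w q.1 * v q.2) F = mean w fun a => mean v fun b => F (a, b) := by
  simp only [mean, Fintype.sum_prod_type, Finset.mul_sum, mul_assoc]

/-- The marginal of an independent family along an injective map of indices. -/
theorem mean_prodWeight_comp {ι κ : Type*} [Fintype ι] [DecidableEq ι] [Fintype κ] [DecidableEq κ]
    (hw : IsWeight w) {e : κ → ι} (he : Function.Injective e) (F : (κ → α) → ℝ) :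
    mean (prodWeight ι w) (fun a => F (a ∘ e)) = mean (prodWeight κ w) F := by
  classical
  let s : κ ⊕ {i // i ∉ Set.range e} ≃ ι :=
    (Equiv.sumCongr (Equiv.ofInjective e he) (Equiv.refl _)).trans (Equiv.Set.sumCompl (Set.range e))
  have hs : ∀ k, s (Sum.inl k) = e k := fun k => by
    simp only [s, Equiv.trans_apply, Equiv.sumCongr_apply, Sum.map_inl]
    exact Equiv.Set.sumCompl_apply_inl _ _
  let E : (κ → α) × ({i // i ∉ Set.range e} → α) ≃ (ι → α) :=
    (Equiv.sumArrowEquivProdArrow _ _ _).symm.trans (Equiv.arrowCongr s (Equiv.refl α))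
  have hE : ∀ q i, E q (s i) = Sum.elim q.1 q.2 i := fun q i => by
    simp [E, Equiv.arrowCongr, Equiv.sumArrowEquivProdArrow]
  have h1 : prodWeight ι w ∘ E = fun q => prodWeight κ w q.1 *
      prodWeight {i // i ∉ Set.range e} w q.2 := by
    funext q
    simp only [prodWeight, Function.comp]
    rw [← Equiv.prod_comp s]
    simp [hE]
  have h2 : (fun a => F (a ∘ e)) ∘ E = fun q => F q.1 := by
    funext q
    simp only [Function.comp_def]
    congr 1
    funext k
    rw [← hs, hE]
    rfl
  rw [mean_equiv E, h1, h2, mean_prod]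
  simp [(isWeight_prodWeight hw).mean_const]

/-- The law of the images of an independent family under a map. -/
theorem mean_prodWeight_map {ι β : Type*} [Fintype ι] [DecidableEq ι] [Fintype β] [DecidableEq β]
    (w : α → ℝ) (φ : α → β) (H : (ι → β) → ℝ) :
    mean (prodWeight ι w) (fun a => H (φ ∘ a))
      = mean (prodWeight ι fun b => mean w fun a => if φ a = b then 1 else 0) H := by
  simp only [mean, prodWeight]
  have h : ∀ z : ι → β, (∏ i, ∑ a, w a * (if φ a = z i then (1 : ℝ) else 0))
      = ∑ a : ι → α, (∏ i, w (a i)) * if φ ∘ a = z then 1 else 0 := by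
    intro z
    rw [Finset.prod_univ_sum, Fintype.piFinset_univ]
    refine Finset.sum_congr rfl fun a _ => ?_
    rw [Finset.prod_mul_distrib, Finset.prod_ite_zero]
    simp [funext_iff]
  simp only [h, Finset.sum_mul]
  rw [Finset.sum_comm]
  refine Finset.sum_congr rfl fun a _ => ?_
  simp

/-- Splitting an independent family indexed by `Option (κ × ι)`. -/
theorem mean_prodWeight_option {ι κ : Type*} [Fintype ι] [DecidableEq ι] [Fintype κ]
    [DecidableEq κ] (w : α → ℝ) (F : (Option (κ × ι) → α) → ℝ) :
    mean (prodWeight (Option (κ × ι)) w) F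
      = mean w fun x => mean (prodWeight κ (prodWeight ι w)) fun g =>
          F fun p => p.elim x fun q => g q.1 q.2 := by
  let E : α × (κ → ι → α) ≃ (Option (κ × ι) → α) :=
    { toFun := fun q p => p.elim q.1 fun r => q.2 r.1 r.2
      invFun := fun a => (a none, fun k i => a (some (k, i)))
      left_inv := fun q => rfl
      right_inv := fun a => by
        funext p
        rcases p with _ | p <;> rfl }
  have h : prodWeight (Option (κ × ι)) w ∘ E
      = fun q => w q.1 * prodWeight κ (prodWeight ι w) q.2 := by
    funext q
    simp only [prodWeight, Function.comp_apply, Fintype.prod_option, Fintype.prod_prod_type]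
    rfl
  rw [mean_equiv E, h, mean_prod]
  rfl

theorem mean_prodWeight_prod {ι β : Type*} [Fintype ι] [DecidableEq ι] [Fintype β]
    (w : α → ℝ) (v : β → ℝ) (F : (ι → α × β) → ℝ) :
    mean (prodWeight ι fun q : α × β => w q.1 * v q.2) F
      = mean (prodWeight ι w) fun a => mean (prodWeight ι v) fun b => F fun i => (a i, b i) := by
  rw [mean_equiv (Equiv.arrowProdEquivProdArrow ι (fun _ => α) (fun _ => β)).symm, 
    ← mean_prod (prodWeight ι w) (prodWeight ι v) fun q => F fun i => (q.1 i, q.2 i)]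
  congr 1
  funext q
  simp [prodWeight, Finset.prod_mul_distrib, Equiv.arrowProdEquivProdArrow]

/-- If the set `A ω` of indices that an exploration reads, and its result `G ω`, depend on `ω` only
through the entries in `A ω`, then, as long as the entries that are read carry distinct labels, it
makes no difference whether the entries are independent or are looked up in an independent family
that is indexed by the labels. -/
theorem mean_exploration {I J : Type*} [Fintype I] [DecidableEq I] [Fintype J] [DecidableEq J]
    [Nonempty α] (hw : IsWeight w) (l : I → J) (A : (I → α) → Finset I)
    (hA : ∀ ω ω', (∀ p ∈ A ω, ω' p = ω p) → A ω' = A ω) (G : (I → α) → ℝ)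
    (hG : ∀ ω ω', (∀ p ∈ A ω, ω' p = ω p) → G ω' = G ω) [DecidablePred fun B : Finset I => Set.InjOn l B] :
    mean (prodWeight J w) (fun ρ => if Set.InjOn l (A (ρ ∘ l)) then G (ρ ∘ l) else 0)
      = mean (prodWeight I w) fun ω => if Set.InjOn l (A ω) then G ω else 0 := by
  classical
  -- Condition on the explored set `B`: injectivity then concerns `B` alone, and on an injective `B`
  -- both models give an independent family indexed by `B`.
  have key : ∀ ω, (if Set.InjOn l (A ω) then G ω else 0)
      = ∑ B : Finset I, if Set.InjOn l B then (if A ω = B then G ω else 0) else 0 := by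
    intro ω
    rw [Finset.sum_eq_single (A ω)]
    · simp
    · intro B _ hB
      simp [hB.symm]
    · simp
  simp only [key, mean_sum]
  refine Finset.sum_congr rfl fun B _ => ?_
  split_ifs with hB
  · let x₀ : α := Classical.arbitrary α
    -- The entries outside `B` are filled with an arbitrary value, which cannot matter: the entries
    -- in `B` alone decide whether `B` is the explored set, and then the result.
    let H : (B → α) → ℝ := fun η =>
      (fun ω => if A ω = B then G ω else 0) fun p => if h : p ∈ B then η ⟨p, h⟩ else x₀
    have hH : ∀ ω, (if A ω = B then G ω else 0) = H fun p => ω p := by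
      intro ω
      simp only [H]
      by_cases h : A ω = B
      · have hl : ∀ p ∈ A ω, (if h : p ∈ B then ω p else x₀) = ω p := fun p hp => by
          rw [h] at hp
          simp [hp]
        have h1 := hA ω (fun p => if h : p ∈ B then ω p else x₀) hl
        have h2 := hG ω (fun p => if h : p ∈ B then ω p else x₀) hl
        rw [if_pos h, if_pos (h1.trans h), h2]
      · rw [if_neg h, if_neg]
        intro h'
        refine h (Eq.trans ?_ h')
        -- Here `hA` starts from the filled labelling: if that one explores `B`, then so does `ω`.
        refine hA _ _ fun p hp => ?_
        rw [h'] at hp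
        simp [hp]
    simp only [hH]
    exact (mean_prodWeight_comp hw (e := fun p : B => l p) (fun p q h =>
      Subtype.ext (hB p.2 q.2 h)) H).trans
      (mean_prodWeight_comp hw (e := fun p : B => (p : I)) Subtype.val_injective H).symm
  · simp [mean]

end Mean

end

end RBN

/-! ### Unrolling a network into a tree, and sensitivities. -/

namespace RBN

noncomputable section

/-- The nodes of the complete `n`-ary tree of depth `t`: the root, or, for a tree of positive depth,
a child of the root together with a node of its subtree. The only node of the tree of depth `0` is
a leaf. -/
inductive TreeNode (n : ℕ) : ℕ → Type
  | leaf : TreeNode n 0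
  | root {t : ℕ} : TreeNode n (t + 1)
  | child {t : ℕ} (u : Fin n) (p : TreeNode n t) : TreeNode n (t + 1)

open TreeNode

/-- The tree of depth `0` is a single leaf. -/
def TreeNode.equivUnit (n : ℕ) : Unit ≃ TreeNode n 0 where
  toFun _ := leaf
  invFun _ := ()
  left_inv _ := rfl
  right_inv p := by cases p; rfl

/-- The nodes of a tree of positive depth are the root and the nodes of the subtrees. -/
def TreeNode.equivOption (n t : ℕ) : Option (Fin n × TreeNode n t) ≃ TreeNode n (t + 1) where
  toFun p := p.elim root fun q => child q.1 q.2
  invFun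
    | root => none
    | child u p => some (u, p)
  left_inv p := by rcases p with _ | p <;> rfl
  right_inv p := by cases p <;> rfl

instance TreeNode.instFintype (n : ℕ) : ∀ t, Fintype (TreeNode n t)
  | 0 => Fintype.ofEquiv Unit (equivUnit n)
  | t + 1 =>
    have := TreeNode.instFintype n t
    Fintype.ofEquiv (Option (Fin n × TreeNode n t)) (equivOption n t)

instance TreeNode.instDecidableEq (n t : ℕ) : DecidableEq (TreeNode n t) := Classical.decEq _

theorem TreeNode.sum_zero {M : Type*} [AddCommMonoid M] {n : ℕ} (F : TreeNode n 0 → M) :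
    ∑ p, F p = F leaf := by
  rw [← Equiv.sum_comp (equivUnit n)]
  simp [equivUnit]

theorem TreeNode.sum_succ {M : Type*} [AddCommMonoid M] {n t : ℕ} (F : TreeNode n (t + 1) → M) :
    ∑ p, F p = F root + ∑ u, ∑ p, F (child u p) := by
  rw [← Equiv.sum_comp (equivOption n t), Fintype.sum_option, Fintype.sum_prod_type]
  rfl

/-- A rule together with an initial state. -/
abbrev Entry (n : ℕ) : Type := NodeRule n × Bool

variable {n : ℕ}

/-- The restriction of a labelling of the tree to the subtree at the child `u` of the root. -/
def subtree {α : Type*} {t : ℕ} (ω : TreeNode n (t + 1) → α) (u : Fin n) : TreeNode n t → α :=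
  fun p => ω (child u p)

/-- The new state of a node with rule `r` when the present state of the network is `x`. -/
def applyRule (r : NodeRule n) (x : Fin n → Bool) : Bool :=
  r.2 fun j => x (r.1.orderEmbOfFin rfl j)

/-- The value at the root: inner nodes apply their rules, leaves have their initial states. -/
def treeValue : ∀ t, (TreeNode n t → Entry n) → Bool
  | 0, ω => (ω leaf).2
  | t + 1, ω => applyRule (ω root).1 fun u => treeValue t (subtree ω u)

/-- The nodes of the tree that are connected to the root through in-neighbours. -/
def Reached : ∀ t, (TreeNode n t → Entry n) → TreeNode n t → Prop
  | 0, _, _ => True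
  | _ + 1, _, root => True
  | t + 1, ω, child u p => u ∈ (ω root).1.1 ∧ Reached t (subtree ω u) p

/-- The node of the network that a node of the tree stands for, where the root stands for `a`; the
bit tells leaves from inner nodes. -/
def place : ∀ t, Fin n → TreeNode n t → Fin n × Bool
  | 0, a, _ => (a, true)
  | _ + 1, a, root => (a, false)
  | t + 1, _, child u p => place t u p

/-- Flip the initial state at `p`. -/
def flipBit {I : Type*} [DecidableEq I] (ω : I → Entry n) (p : I) : I → Entry n :=
  Function.update ω p ((ω p).1, !(ω p).2)

section FlipBit

variable {I J : Type*} [DecidableEq I] [DecidableEq J]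

theorem flipBit_self (ω : I → Entry n) (p : I) : flipBit ω p p = ((ω p).1, !(ω p).2) := by
  simp [flipBit]

theorem flipBit_of_ne (ω : I → Entry n) {p q : I} (h : q ≠ p) : flipBit ω p q = ω q := by
  simp [flipBit, h]

theorem flipBit_fst (ω : I → Entry n) (p q : I) : (flipBit ω p q).1 = (ω q).1 := by
  by_cases h : q = p
  · subst h
    rw [flipBit_self]
  · rw [flipBit_of_ne ω h]

theorem flipBit_comp (ω : J → Entry n) (l : I → J) (p q : I) (h : l q = l p → q = p) :
    flipBit ω (l p) (l q) = flipBit (ω ∘ l) p q := by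
  by_cases hq : q = p
  · subst hq
    rw [flipBit_self, flipBit_self]
    rfl
  · rw [flipBit_of_ne _ hq, flipBit_of_ne _ fun h' => hq (h h')]
    rfl

end FlipBit

theorem applyRule_congr {r : NodeRule n} {x y : Fin n → Bool} (h : ∀ u ∈ r.1, x u = y u) :
    applyRule r x = applyRule r y := by
  unfold applyRule
  refine congrArg r.2 (funext fun j => ?_)
  exact h _ (Finset.orderEmbOfFin_mem _ _ _)

/-- Only rules decide what is reached, so the reached set survives flips of initial states. -/
theorem reached_congr : ∀ {t : ℕ} {ω ω' : TreeNode n t → Entry n},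
    (∀ p, Reached t ω p → (ω' p).1 = (ω p).1) → ∀ p, Reached t ω' p ↔ Reached t ω p
  | 0, _, _, _, leaf => Iff.rfl
  | _ + 1, _, _, _, root => Iff.rfl
  | t + 1, ω, ω', h, child u p => by
    have h0 : (ω' root).1 = (ω root).1 := h root trivial
    simp only [Reached, h0]
    refine and_congr_right fun hu => ?_
    exact reached_congr (fun q hq => h (child u q) ⟨hu, hq⟩) p

theorem treeValue_congr : ∀ {t : ℕ} {ω ω' : TreeNode n t → Entry n},
    (∀ p, Reached t ω p → ω' p = ω p) → treeValue t ω' = treeValue t ω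
  | 0, _, _, h => congrArg Prod.snd (h leaf trivial)
  | t + 1, ω, ω', h => by
    have h0 : (ω' root).1 = (ω root).1 := congrArg Prod.fst (h root trivial)
    simp only [treeValue, h0]
    exact applyRule_congr fun u hu => treeValue_congr fun p hp => h (child u p) ⟨hu, hp⟩

theorem treeValue_flipBit_of_not_reached {t : ℕ} {ω : TreeNode n t → Entry n} {p : TreeNode n t}
    (hp : ¬ Reached t ω p) : treeValue t (flipBit ω p) = treeValue t ω :=
  treeValue_congr fun _ hq => flipBit_of_ne ω fun h => hp (h ▸ hq)

/-- `place` forgets the depth of inner nodes, so a network node uses the same rule at all times.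
Rules come from the entries with bit `false` and initial states from those with bit `true`, so a
leaf and an inner node over the same network node share no label. -/
theorem treeValue_place (ρ : Fin n × Bool → Entry n) : ∀ (t : ℕ) (a : Fin n),
    treeValue t (ρ ∘ place t a)
      = stateAt (fun u => (ρ (u, false)).1) t (fun u => (ρ (u, true)).2) a
  | 0, _ => rfl
  | t + 1, a => by
    simp only [stateAt, Function.iterate_succ_apply', step]
    change applyRule (ρ (a, false)).1 (fun u => treeValue t (ρ ∘ place t u)) = _
    simp only [treeValue_place ρ t]
    rfl

/-- The number of nodes of the tree at which a flip of the initial state changes the value at the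
root. -/
def sensitivity (t : ℕ) (ω : TreeNode n t → Entry n) : ℝ :=
  ∑ p, if treeValue t (flipBit ω p) ≠ treeValue t ω then 1 else 0

/-- The number of nodes of the network at which a flip of the initial state changes the state of `a`
at time `t`. -/
def networkSensitivity (t : ℕ) (a : Fin n) (ρ : Fin n × Bool → Entry n) : ℝ :=
  ∑ c, if treeValue t (flipBit ρ c ∘ place t a) ≠ treeValue t (ρ ∘ place t a) then 1 else 0

theorem sensitivity_nonneg (t : ℕ) (ω : TreeNode n t → Entry n) : 0 ≤ sensitivity t ω :=
  Finset.sum_nonneg fun _ _ => by split_ifs <;> norm_num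

theorem networkSensitivity_nonneg (t : ℕ) (a : Fin n) (ρ : Fin n × Bool → Entry n) :
    0 ≤ networkSensitivity t a ρ :=
  Finset.sum_nonneg fun _ _ => by split_ifs <;> norm_num

open Classical in
/-- The set of reached nodes. -/
def reachedSet (t : ℕ) (ω : TreeNode n t → Entry n) : Finset (TreeNode n t) :=
  Finset.univ.filter (Reached t ω)

theorem mem_reachedSet {t : ℕ} {ω : TreeNode n t → Entry n} {p : TreeNode n t} :
    p ∈ reachedSet t ω ↔ Reached t ω p := by
  simp [reachedSet]

theorem reachedSet_congr {t : ℕ} {ω ω' : TreeNode n t → Entry n}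
    (h : ∀ p ∈ reachedSet t ω, ω' p = ω p) : reachedSet t ω' = reachedSet t ω := by
  ext p
  rw [mem_reachedSet, mem_reachedSet]
  exact reached_congr (fun q hq => by rw [h q (mem_reachedSet.2 hq)]) p

theorem reached_flipBit {t : ℕ} (ω : TreeNode n t → Entry n) (p q : TreeNode n t) :
    Reached t (flipBit ω p) q ↔ Reached t ω q :=
  reached_congr (fun r _ => flipBit_fst ω p r) q

/-- With `reachedSet_congr`, this supplies the locality hypotheses of `mean_exploration`. -/
theorem sensitivity_congr {t : ℕ} {ω ω' : TreeNode n t → Entry n}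
    (h : ∀ p ∈ reachedSet t ω, ω' p = ω p) : sensitivity t ω' = sensitivity t ω := by
  refine Finset.sum_congr rfl fun p _ => ?_
  have h' : ∀ q, Reached t ω q → ω' q = ω q := fun q hq => h q (mem_reachedSet.2 hq)
  rw [treeValue_congr h']
  have : treeValue t (flipBit ω' p) = treeValue t (flipBit ω p) := by
    refine treeValue_congr fun q hq => ?_
    rw [reached_flipBit] at hq
    by_cases hqp : q = p
    · subst hqp
      rw [flipBit_self, flipBit_self, h' q hq]
    · rw [flipBit_of_ne _ hqp, flipBit_of_ne _ hqp, h' q hq]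
  rw [this]

/-- If the reached nodes of the unrolled network stand for distinct nodes, its sensitivity is that of
the tree. -/
theorem networkSensitivity_eq {t : ℕ} {a : Fin n} {ρ : Fin n × Bool → Entry n}
    (h : Set.InjOn (place t a) (reachedSet t (ρ ∘ place t a))) :
    networkSensitivity t a ρ = sensitivity t (ρ ∘ place t a) := by
  have h1 : networkSensitivity t a ρ
      = ∑ c ∈ (reachedSet t (ρ ∘ place t a)).image (place t a),
        if treeValue t (flipBit ρ c ∘ place t a) ≠ treeValue t (ρ ∘ place t a) then 1 else 0 := by
    refine (Finset.sum_subset (Finset.subset_univ _) fun c _ hc => ?_).symm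
    rw [if_neg]
    refine not_not.2 (treeValue_congr fun p hp => flipBit_of_ne ρ fun hpc => hc ?_)
    exact Finset.mem_image.2 ⟨p, mem_reachedSet.2 hp, hpc⟩
  have h2 : sensitivity t (ρ ∘ place t a) = ∑ p ∈ reachedSet t (ρ ∘ place t a),
      if treeValue t (flipBit (ρ ∘ place t a) p) ≠ treeValue t (ρ ∘ place t a) then 1 else 0 := by
    refine (Finset.sum_subset (Finset.subset_univ _) fun p _ hp => ?_).symm
    rw [mem_reachedSet] at hp
    rw [if_neg (not_not.2 (treeValue_flipBit_of_not_reached hp))]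
  rw [h1, h2, Finset.sum_image h]
  refine Finset.sum_congr rfl fun p hp => ?_
  -- A flip in the network flips every tree node over the same place; by injectivity only one of
  -- these is reached.
  have : treeValue t (flipBit ρ (place t a p) ∘ place t a)
      = treeValue t (flipBit (ρ ∘ place t a) p) := by
    refine treeValue_congr fun q hq => ?_
    rw [reached_flipBit] at hq
    exact flipBit_comp ρ (place t a) p q fun hqp => h (mem_reachedSet.2 hq) hp hqp
  rw [this]

/-- A flip that changes the state of `a` must change the state of an in-neighbour one step earlier.
A union bound over at most `K` in-neighbours gives the induction, with no assumption on
coincidences. -/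
theorem networkSensitivity_le {K : ℕ} {ρ : Fin n × Bool → Entry n}
    (hρ : ∀ c, (ρ c).1.1.card ≤ K) : ∀ (t : ℕ) (a : Fin n), networkSensitivity t a ρ ≤ (K : ℝ) ^ t
  | 0, a => by
    have h : networkSensitivity 0 a ρ ≤ ∑ c : Fin n × Bool, if c = (a, true) then 1 else 0 := by
      refine Finset.sum_le_sum fun c _ => ?_
      by_cases hc : c = (a, true)
      · rw [if_pos hc]
        split_ifs <;> norm_num
      · rw [if_neg hc, if_neg]
        refine not_not.2 ?_
        change (flipBit ρ c (a, true)).2 = _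
        rw [flipBit_of_ne _ (Ne.symm hc)]
        rfl
    simpa using h
  | t + 1, a => by
    have h : networkSensitivity (t + 1) a ρ
        ≤ ∑ u ∈ (ρ (a, false)).1.1, networkSensitivity t u ρ := by
      unfold networkSensitivity
      rw [Finset.sum_comm]
      refine Finset.sum_le_sum fun c _ => ?_
      have hnn : ∀ u ∈ (ρ (a, false)).1.1, (0 : ℝ) ≤
          if treeValue t (flipBit ρ c ∘ place t u) ≠ treeValue t (ρ ∘ place t u) then 1 else 0 :=
        fun u _ => by split_ifs <;> norm_num
      split_ifs with hc
      · have : ∃ u ∈ (ρ (a, false)).1.1,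
            treeValue t (flipBit ρ c ∘ place t u) ≠ treeValue t (ρ ∘ place t u) := by
          by_contra! hcon
          refine hc ?_
          change applyRule (flipBit ρ c (a, false)).1
            (fun u => treeValue t (flipBit ρ c ∘ place t u))
            = applyRule (ρ (a, false)).1 fun u => treeValue t (ρ ∘ place t u)
          rw [flipBit_fst]
          exact applyRule_congr hcon
        obtain ⟨u, hu, hne⟩ := this
        refine le_trans ?_ (Finset.single_le_sum hnn hu)
        rw [if_pos hne]
      · exact Finset.sum_nonneg hnn
    refine h.trans ?_
    calc ∑ u ∈ (ρ (a, false)).1.1, networkSensitivity t u ρ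
        ≤ ∑ u ∈ (ρ (a, false)).1.1, (K : ℝ) ^ t :=
          Finset.sum_le_sum fun u _ => networkSensitivity_le hρ t u
      _ = ((ρ (a, false)).1.1.card : ℝ) * (K : ℝ) ^ t := by simp
      _ ≤ (K : ℝ) * (K : ℝ) ^ t := by
          gcongr
          exact_mod_cast hρ _
      _ = (K : ℝ) ^ (t + 1) := by ring

theorem subtree_flipBit_self {t : ℕ} (ω : TreeNode n (t + 1) → Entry n) (u : Fin n)
    (p : TreeNode n t) : subtree (flipBit ω (child u p)) u = flipBit (subtree ω u) p := by
  funext q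
  exact flipBit_comp ω (fun q => child u q) p q fun h => by simpa using h

theorem subtree_flipBit_of_ne {t : ℕ} (ω : TreeNode n (t + 1) → Entry n) {u v : Fin n}
    (h : v ≠ u) (p : TreeNode n t) : subtree (flipBit ω (child u p)) v = subtree ω v := by
  funext q
  exact flipBit_of_ne ω fun hq => h (by injection hq)

/-- The values that the rule at the root reads. -/
def rootInputs {t : ℕ} (S : Finset (Fin n)) (g : Fin n → TreeNode n t → Entry n) :
    Fin S.card → Bool :=
  fun j => treeValue t (g (S.orderEmbOfFin rfl j))

/-- Whether a flip of the input `j` changes the value of `f` at `z`. -/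
def pivotal {d : ℕ} (f : BoolFun d) (z : Fin d → Bool) (j : Fin d) : ℝ :=
  if f z ≠ f (flip z j) then 1 else 0

/-- The subtrees are disjoint, so a flip below one child can alter only the input from that child.
It changes the root iff it changes this input and the input is pivotal. -/
theorem sensitivity_succ {t : ℕ} (ω : TreeNode n (t + 1) → Entry n) :
    sensitivity (t + 1) ω
      = ∑ j, pivotal (ω root).1.2 (rootInputs (ω root).1.1 (subtree ω)) j
          * sensitivity t (subtree ω ((ω root).1.1.orderEmbOfFin rfl j)) := by
  set S := (ω root).1.1 with hS
  have hval : ∀ p, treeValue (t + 1) (flipBit ω p)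
      = applyRule (ω root).1 fun u => treeValue t (subtree (flipBit ω p) u) := fun p => by
    change applyRule (flipBit ω p root).1 _ = _
    rw [flipBit_fst]
  have hnone : ∀ u, subtree (flipBit ω root) u = subtree ω u := fun u => by
    funext q
    exact flipBit_of_ne ω (by simp)
  have hu : ∀ u ∉ S, ∀ p, treeValue (t + 1) (flipBit ω (child u p)) = treeValue (t + 1) ω :=
    fun u hu p => treeValue_flipBit_of_not_reached fun h => hu h.1
  have h1 : sensitivity (t + 1) ω = ∑ u, ∑ p,
      if treeValue (t + 1) (flipBit ω (child u p)) ≠ treeValue (t + 1) ω then (1 : ℝ) else 0 := by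
    unfold sensitivity
    -- The root is an inner node, so its own state bit is never read.
    rw [sum_succ, if_neg, zero_add]
    rw [hval root]
    simp only [hnone]
    exact not_not.2 rfl
  rw [h1, ← Finset.sum_subset (Finset.subset_univ S) fun u _ h =>
      Finset.sum_eq_zero fun p _ => if_neg (not_not.2 (hu u h p)),
    ← Finset.map_orderEmbOfFin_univ S rfl, Finset.sum_map]
  refine Finset.sum_congr rfl fun j _ => ?_
  unfold sensitivity
  rw [Finset.mul_sum]
  refine Finset.sum_congr rfl fun p _ => ?_
  set v := S.orderEmbOfFin rfl j with hv
  have hne : ∀ k, k ≠ j → S.orderEmbOfFin rfl k ≠ v := fun k hk h =>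
    hk ((S.orderEmbOfFin rfl).injective h)
  have hleft : treeValue (t + 1) (flipBit ω (child v p)) = (ω root).1.2
      (Function.update (rootInputs S (subtree ω)) j (treeValue t (flipBit (subtree ω v) p))) := by
    rw [hval]
    refine congrArg (ω root).1.2 (funext fun k => ?_)
    by_cases hk : k = j
    · subst hk
      rw [Function.update_self, ← subtree_flipBit_self]
    · rw [Function.update_of_ne hk]
      exact congrArg (treeValue t) (subtree_flipBit_of_ne ω (hne k hk) p)
  have hright : treeValue (t + 1) ω = (ω root).1.2 (rootInputs S (subtree ω)) := rfl
  have hj : rootInputs S (subtree ω) j = treeValue t (subtree ω v) := rfl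
  change (if treeValue (t + 1) (flipBit ω (child v p)) ≠ _ then (1 : ℝ) else 0) = _
  rw [hleft, hright]
  -- A bit either stays, and both sides vanish, or is negated, and the update is exactly the flip in
  -- `pivotal`.
  by_cases hp : treeValue t (flipBit (subtree ω v) p) = treeValue t (subtree ω v)
  · rw [hp, ← hj, Function.update_eq_self]
    simp
  · have : treeValue t (flipBit (subtree ω v) p) = !(treeValue t (subtree ω v)) := by
      revert hp
      cases treeValue t (flipBit (subtree ω v) p) <;> cases treeValue t (subtree ω v) <;> simp
    rw [this, ← hj]
    rw [if_pos (show (!rootInputs S (subtree ω) j) ≠ rootInputs S (subtree ω) j by simp), mul_one]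
    exact if_congr ne_comm rfl rfl

theorem pivotal_le_one {d : ℕ} (f : BoolFun d) (z : Fin d → Bool) (j : Fin d) :
    pivotal f z j ≤ 1 := by
  unfold pivotal
  split_ifs <;> norm_num

theorem sensitivity_zero (ω : TreeNode n 0 → Entry n) : sensitivity 0 ω = 1 := by
  have : treeValue 0 (flipBit ω leaf) ≠ treeValue 0 ω := by
    simp [treeValue, flipBit_self]
  rw [sensitivity, sum_zero, if_pos this]

theorem sensitivity_le {K : ℕ} : ∀ {t : ℕ} {ω : TreeNode n t → Entry n},
    (∀ p, (ω p).1.1.card ≤ K) → sensitivity t ω ≤ (K : ℝ) ^ t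
  | 0, ω, _ => by rw [sensitivity_zero, pow_zero]
  | t + 1, ω, hω => by
    rw [sensitivity_succ]
    calc _ ≤ ∑ _j : Fin (ω root).1.1.card, (K : ℝ) ^ t := by
          refine Finset.sum_le_sum fun j _ => ?_
          refine (mul_le_mul_of_nonneg_right (pivotal_le_one _ _ _) (sensitivity_nonneg _ _)).trans ?_
          rw [one_mul]
          exact sensitivity_le fun p => hω _
      _ = ((ω root).1.1.card : ℝ) * (K : ℝ) ^ t := by simp
      _ ≤ (K : ℝ) * (K : ℝ) ^ t := by
          gcongr
          exact_mod_cast hω root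
      _ = (K : ℝ) ^ (t + 1) := by ring

end

end RBN

/-! ### The law of a random rule, and what the two conditions on transfer functions give. -/

namespace RBN

noncomputable section

open TreeNode

variable {n : ℕ}

/-- The probabilities of a probability mass function as real numbers. -/
def realWeight {α : Type*} (P : PMF α) : α → ℝ := fun a => (P a).toReal

theorem isWeight_realWeight {α : Type*} [Fintype α] (P : PMF α) : IsWeight (realWeight P) where
  nonneg _ := ENNReal.toReal_nonneg
  sum_eq_one := by
    unfold realWeight
    rw [← ENNReal.toReal_sum fun a _ => P.apply_ne_top a, ← tsum_fintype (L := .unconditional _),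
      P.tsum_coe, ENNReal.toReal_one]

theorem expectation_eq_mean {α : Type*} [Fintype α] (P : PMF α) (g : α → ℝ) :
    expectation P g = mean (realWeight P) g := rfl

/-- The weight of a random rule. -/
def ruleWeight (n : ℕ) (D : PMF ℕ) (T : (d : ℕ) → PMF (BoolFun d)) : NodeRule n → ℝ :=
  fun r => (D r.1.card).toReal / (n.choose r.1.card) * realWeight (T r.1.card) r.2

theorem realWeight_randomRule (D : PMF ℕ) (T : (d : ℕ) → PMF (BoolFun d))
    (hD : ∀ d ∈ D.support, d ≤ n) :
    realWeight (randomRule n D T hD) = ruleWeight n D T := by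
  classical
  funext ⟨S, f⟩
  have hmap : ∀ S' : Finset (Fin n), ((T S'.card).map fun f => (⟨S', f⟩ : NodeRule n)) ⟨S, f⟩
      = if S' = S then T S.card f else 0 := by
    intro S'
    rw [PMF.map_apply]
    split_ifs with h
    · subst h
      rw [tsum_eq_single f]
      · simp
      · intro f' hf'
        rw [if_neg]
        intro h
        simp only [Sigma.mk.injEq, heq_eq_eq, true_and] at h
        exact hf' h.symm
    · rw [ENNReal.tsum_eq_zero]
      intro f'
      rw [if_neg]
      intro h'
      exact h (congrArg Sigma.fst h').symm
  have h1 : randomRule n D T hD ⟨S, f⟩ = D S.card * ((n.choose S.card : ENNReal)⁻¹ * T S.card f) := by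
    unfold randomRule
    rw [PMF.bindOnSupport_apply, tsum_eq_single S.card]
    · by_cases h : D S.card = 0
      · simp [h]
      · rw [dif_neg h, PMF.bind_apply, tsum_eq_single S]
        · rw [hmap, if_pos rfl, PMF.uniformOfFinset_apply_of_mem]
          · simp
          · simp
        · intro S' hS'
          rw [hmap, if_neg hS', mul_zero]
    · intro d hd
      by_cases h : D d = 0
      · simp [h]
      · rw [dif_neg h, PMF.bind_apply]
        refine mul_eq_zero_of_right _ (ENNReal.tsum_eq_zero.2 fun S' => ?_)
        rw [hmap]
        split_ifs with hS'
        · subst hS'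
          rw [PMF.uniformOfFinset_apply_of_notMem, zero_mul]
          simp only [Finset.mem_powersetCard_univ]
          exact fun h => hd h.symm
        · rw [mul_zero]
  simp only [realWeight, h1, ruleWeight, ENNReal.toReal_mul, ENNReal.toReal_inv,
    ENNReal.toReal_natCast]
  ring

section RuleWeight

variable {K : ℕ} {D : PMF ℕ} {T : (d : ℕ) → PMF (BoolFun d)}

theorem mean_ruleWeight_eq (D : PMF ℕ) (T : (d : ℕ) → PMF (BoolFun d)) (G : NodeRule n → ℝ) :
    mean (ruleWeight n D T) G = ∑ S : Finset (Fin n), (D S.card).toReal / (n.choose S.card)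
      * mean (realWeight (T S.card)) fun f => G ⟨S, f⟩ := by
  simp only [mean, Fintype.sum_sigma, ruleWeight, Finset.mul_sum, mul_assoc]

theorem sum_finset_eq (hK : K ≤ n) (hD : ∀ d ∈ D.support, 1 ≤ d ∧ d ≤ K)
    (φ : Finset (Fin n) → ℝ) :
    ∑ S : Finset (Fin n), (D S.card).toReal / (n.choose S.card) * φ S
      = ∑ d ∈ Finset.Icc 1 K, (D d).toReal
          * ((n.choose d : ℝ)⁻¹ * ∑ S ∈ Finset.powersetCard d Finset.univ, φ S) := by
  rw [← Finset.powerset_univ, Finset.sum_powerset, Finset.card_univ, Fintype.card_fin]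
  symm
  refine Finset.sum_subset_zero_on_sdiff (fun d hd => ?_) (fun d hd => ?_) fun d _ => ?_
  · simp only [Finset.mem_Icc, Finset.mem_range] at hd ⊢
    omega
  · have : D d = 0 := by
      by_contra h
      have := hD d h
      simp only [Finset.mem_sdiff, Finset.mem_Icc] at hd
      exact hd.2 this
    refine Finset.sum_eq_zero fun S hS => ?_
    rw [(Finset.mem_powersetCard.1 hS).2, this]
    simp
  · rw [Finset.mul_sum, Finset.mul_sum]
    refine Finset.sum_congr rfl fun S hS => ?_
    rw [(Finset.mem_powersetCard.1 hS).2]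
    ring

theorem mean_ruleWeight_card (hK : K ≤ n) (hD : ∀ d ∈ D.support, 1 ≤ d ∧ d ≤ K)
    (H : (d : ℕ) → BoolFun d → ℝ) :
    mean (ruleWeight n D T) (fun r => H r.1.card r.2)
      = ∑ d ∈ Finset.Icc 1 K, (D d).toReal * mean (realWeight (T d)) (H d) := by
  rw [mean_ruleWeight_eq, sum_finset_eq hK hD fun S => mean (realWeight (T S.card)) (H S.card)]
  refine Finset.sum_congr rfl fun d hd => ?_
  congr 1
  rw [Finset.sum_congr rfl fun S hS => by rw [(Finset.mem_powersetCard.1 hS).2]]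
  have : (n.choose d : ℝ) ≠ 0 := by
    simp only [Finset.mem_Icc] at hd
    exact_mod_cast (Nat.choose_pos (by omega)).ne'
  simp [this]

theorem sum_indegree (hD : ∀ d ∈ D.support, 1 ≤ d ∧ d ≤ K) :
    ∑ d ∈ Finset.Icc 1 K, (D d).toReal = 1 := by
  rw [← ENNReal.toReal_sum fun a _ => D.apply_ne_top a, ← tsum_eq_sum (L := .unconditional _), D.tsum_coe,
    ENNReal.toReal_one]
  intro d hd
  by_contra h
  exact hd (Finset.mem_Icc.2 (hD d h))

theorem isWeight_ruleWeight (hK : K ≤ n) (hD : ∀ d ∈ D.support, 1 ≤ d ∧ d ≤ K) :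
    IsWeight (ruleWeight n D T) where
  nonneg r := mul_nonneg (div_nonneg ENNReal.toReal_nonneg (Nat.cast_nonneg _))
    ENNReal.toReal_nonneg
  sum_eq_one := by
    have h := mean_ruleWeight_card (T := T) hK hD fun _ _ => 1
    simp only [(isWeight_realWeight _).mean_const, mul_one, sum_indegree hD] at h
    simpa [mean] using h

theorem card_le_of_ruleWeight_ne_zero (hD : ∀ d ∈ D.support, 1 ≤ d ∧ d ≤ K) {r : NodeRule n}
    (h : ruleWeight n D T r ≠ 0) : r.1.card ≤ K := by
  refine (hD r.1.card fun h0 => h ?_).2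
  simp [ruleWeight, h0]

theorem mean_ruleWeight_influence (hK : K ≤ n) (hD : ∀ d ∈ D.support, 1 ≤ d ∧ d ≤ K) :
    mean (ruleWeight n D T) (fun r => ∑ j, influence r.2 j) = networkInfluence K D T :=
  mean_ruleWeight_card hK hD fun _ f => ∑ j, influence f j

/-- Double counting: each node lies in `(n - 1).choose (d - 1)` of the sets of size `d`, hence in a
fraction `d / n` of them. -/
theorem sum_powersetCard_sum {d : ℕ} (hd : 1 ≤ d) (hdn : d ≤ n) (g : Fin n → ℝ) :
    (n.choose d : ℝ)⁻¹ * ∑ S ∈ Finset.powersetCard d Finset.univ, ∑ u ∈ S, g u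
      = d / n * ∑ u, g u := by
  obtain ⟨d, rfl⟩ : ∃ e, d = e + 1 := ⟨d - 1, by omega⟩
  obtain ⟨m, rfl⟩ : ∃ m, n = m + 1 := ⟨n - 1, by omega⟩
  have hcount : ∀ u : Fin (m + 1),
      (((Finset.powersetCard (d + 1) Finset.univ).filter fun S => u ∈ S).card) = m.choose d := by
    intro u
    have : ((Finset.powersetCard (d + 1) (Finset.univ : Finset (Fin (m + 1)))).filter
        fun S => u ∈ S) = (Finset.powersetCard d (Finset.univ.erase u)).image (insert u) := by
      ext S
      simp only [Finset.mem_filter, Finset.mem_image,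
        Finset.mem_powersetCard]
      constructor
      · rintro ⟨hS, hu⟩
        refine ⟨S.erase u, ⟨Finset.erase_subset_erase _ (Finset.subset_univ _), ?_⟩,
          Finset.insert_erase hu⟩
        rw [Finset.card_erase_of_mem hu, hS.2]
        rfl
      · rintro ⟨R, ⟨hR, hc⟩, rfl⟩
        have hu : u ∉ R := fun h => by simpa using hR h
        exact ⟨⟨Finset.subset_univ _, by rw [Finset.card_insert_of_notMem hu, hc]⟩,
          Finset.mem_insert_self _ _⟩
    rw [this, Finset.card_image_of_injOn, Finset.card_powersetCard, Finset.card_erase_of_mem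
      (Finset.mem_univ u)]
    · simp
    · intro R hR R' hR' h
      have hu : ∀ R ∈ (Finset.powersetCard d (Finset.univ.erase u) : Finset (Finset (Fin (m + 1)))),
          u ∉ R := fun R hR h => by simpa using (Finset.mem_powersetCard.1 hR).1 h
      have h2 := congrArg (fun S => Finset.erase S u) h
      simpa [Finset.erase_insert (hu R hR), Finset.erase_insert (hu R' hR')] using h2
  have hsum : ∑ S ∈ Finset.powersetCard (d + 1) Finset.univ, ∑ u ∈ S, g u
      = (m.choose d : ℝ) * ∑ u, g u := by
    have : ∀ S : Finset (Fin (m + 1)), ∑ u ∈ S, g u = ∑ u, if u ∈ S then g u else 0 := fun S => by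
      simp
    rw [Finset.sum_congr rfl fun S _ => this S, Finset.sum_comm, Finset.mul_sum]
    refine Finset.sum_congr rfl fun u _ => ?_
    rw [← Finset.sum_filter, Finset.sum_const, hcount, nsmul_eq_mul]
  have hch : ((m + 1 : ℕ) : ℝ) * (m.choose d : ℝ)
      = ((m + 1).choose (d + 1) : ℝ) * ((d + 1 : ℕ) : ℝ) := by
    exact_mod_cast Nat.add_one_mul_choose_eq m d
  have h0 : ((m + 1).choose (d + 1) : ℝ) ≠ 0 := by
    exact_mod_cast (Nat.choose_pos hdn).ne'
  have h1 : ((m + 1 : ℕ) : ℝ) ≠ 0 := by positivity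
  rw [hsum, ← mul_assoc]
  congr 1
  rw [inv_mul_eq_div, div_eq_div_iff h0 h1]
  linarith

theorem mean_ruleWeight_sum_le (hK : K ≤ n) (hD : ∀ d ∈ D.support, 1 ≤ d ∧ d ≤ K)
    {g : Fin n → ℝ} (hg : ∀ u, 0 ≤ g u) :
    mean (ruleWeight n D T) (fun r => ∑ u ∈ r.1, g u) ≤ K / n * ∑ u, g u := by
  rw [mean_ruleWeight_eq]
  simp only [(isWeight_realWeight _).mean_const]
  rw [sum_finset_eq hK hD]
  have hs : 0 ≤ ∑ u, g u := Finset.sum_nonneg fun u _ => hg u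
  calc _ ≤ ∑ d ∈ Finset.Icc 1 K, (D d).toReal * (K / n * ∑ u, g u) := by
        refine Finset.sum_le_sum fun d hd => ?_
        rw [Finset.mem_Icc] at hd
        rw [sum_powersetCard_sum hd.1 (hd.2.trans hK)]
        have : (d : ℝ) ≤ K := by exact_mod_cast hd.2
        gcongr
    _ = _ := by rw [← Finset.sum_mul, sum_indegree hD, one_mul]

end RuleWeight

theorem mean_half_eq_expect {ι : Type*} [Fintype ι] [DecidableEq ι] (F : (ι → Bool) → ℝ) :
    mean (prodWeight ι fun _ : Bool => 1 / 2) F = 𝔼 z, F z := by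
  rw [Fintype.expect_eq_sum_div_card, Finset.sum_div]
  refine Finset.sum_congr rfl fun z _ => ?_
  simp [prodWeight]
  ring

theorem influence_eq {d : ℕ} (f : BoolFun d) (j : Fin d) :
    influence f j = 𝔼 z, pivotal f z j := rfl

theorem flip_ne {d : ℕ} (z : Fin d → Bool) (j : Fin d) : flip z j ≠ z := fun h => by
  have := congrFun h j
  simp [flip] at this

/-- Under full independence every input at every point is pivotal with the same probability. -/
theorem FullyIndependent.mean_pivotal {D : PMF ℕ} {T : (d : ℕ) → PMF (BoolFun d)}
    (h : FullyIndependent D T) {d : ℕ} (hd : d ∈ D.support) (z : Fin d → Bool) (j : Fin d) :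
    mean (realWeight (T d)) (fun f => pivotal f z j)
      = mean (realWeight (T d)) fun f => influence f j := by
  obtain ⟨q, hq⟩ := h d hd
  have hT : realWeight (T d) = prodWeight (Fin d → Bool) (realWeight q) := by
    funext f
    simp [realWeight, prodWeight, hq, ENNReal.toReal_prod]
  -- Pivotality at `z` compares two distinct entries of the truth table, whose joint law does not
  -- depend on `z`.
  have hc : ∀ z, mean (realWeight (T d)) (fun f => pivotal f z j)
      = mean (prodWeight Bool (realWeight q)) fun η => if η true ≠ η false then 1 else 0 := by
    intro z
    rw [hT, ← mean_prodWeight_comp (isWeight_realWeight q)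
      (e := fun b : Bool => if b then z else flip z j)]
    · rfl
    · intro b c hbc
      have hne := flip_ne z j
      cases b <;> cases c <;> simp_all [eq_comm]
  simp only [influence_eq, Fintype.expect_eq_sum_div_card, div_eq_mul_inv, mean_mul_right, mean_sum,
    hc]
  simp only [Finset.sum_const, nsmul_eq_mul, Finset.card_univ]
  field_simp

/-- Balance on average as a mean over rules. -/
theorem BalancedOnAverage.mean_output {D : PMF ℕ} {T : (d : ℕ) → PMF (BoolFun d)}
    (h : BalancedOnAverage D T) {K : ℕ} (hK : K ≤ n) (hD : ∀ d ∈ D.support, 1 ≤ d ∧ d ≤ K) :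
    mean (ruleWeight n D T) (fun r => 𝔼 z, if r.2 z = true then 1 else 0) = 1 / 2 := by
  rw [mean_ruleWeight_card (T := T) hK hD fun d f => 𝔼 z, if f z = true then (1 : ℝ) else 0]
  have h1 : (outputLaw D T true).toReal = 1 / 2 := by
    rw [show outputLaw D T true = 1 / 2 from h]
    simp
  rw [← h1]
  have hmap : ∀ d (f : BoolFun d), ((PMF.uniformOfFintype (Fin d → Bool)).map f true).toReal
      = 𝔼 z, if f z = true then (1 : ℝ) else 0 := by
    intro d f
    rw [PMF.map_apply, tsum_fintype, Fintype.expect_eq_sum_div_card, ENNReal.toReal_sum,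
      Finset.sum_div]
    · refine Finset.sum_congr rfl fun z _ => ?_
      by_cases hz : f z = true <;> simp [hz]
    · intro z _
      split_ifs
      · exact PMF.apply_ne_top _ _
      · simp
  unfold outputLaw
  rw [PMF.bind_apply, tsum_eq_sum (s := Finset.Icc 1 K), ENNReal.toReal_sum]
  · refine Finset.sum_congr rfl fun d _ => ?_
    rw [ENNReal.toReal_mul, PMF.bind_apply, tsum_fintype, ENNReal.toReal_sum]
    · congr 1
      refine Finset.sum_congr rfl fun f _ => ?_
      rw [ENNReal.toReal_mul, hmap]
      rfl
    · exact fun f _ => ENNReal.mul_ne_top (PMF.apply_ne_top _ _) (PMF.apply_ne_top _ _)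
  · exact fun d _ => ENNReal.mul_ne_top (PMF.apply_ne_top _ _) (PMF.apply_ne_top _ _)
  · intro d hd
    have : D d = 0 := by
      by_contra h
      exact hd (Finset.mem_Icc.2 (hD d h))
    rw [this, zero_mul]

end

end RBN

/-! ### Mean sensitivity of the independently labelled tree, and the number of coincidences in it.
-/

namespace RBN

noncomputable section

open TreeNode

variable {n : ℕ}

theorem mean_tree_zero {α : Type*} [Fintype α] {w : α → ℝ} (hw : IsWeight w)
    (F : α → ℝ) : mean (prodWeight (TreeNode n 0) w) (fun ω => F (ω leaf)) = mean w F :=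
  mean_prodWeight_apply hw leaf F

/-- The labelling of a tree with label `x` at the root and labellings `g` of the subtrees. -/
def graft {α : Type*} {t : ℕ} (x : α) (g : Fin n → TreeNode n t → α) : TreeNode n (t + 1) → α
  | root => x
  | child u p => g u p

theorem graft_root {α : Type*} {t : ℕ} (x : α) (g : Fin n → TreeNode n t → α) :
    graft x g root = x := rfl

theorem subtree_graft {α : Type*} {t : ℕ} (x : α) (g : Fin n → TreeNode n t → α) :
    subtree (graft x g) = g := rfl

theorem sensitivity_graft {t : ℕ} (x : Entry n) (g : Fin n → TreeNode n t → Entry n) :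
    sensitivity (t + 1) (graft x g) = ∑ j, pivotal x.1.2 (rootInputs x.1.1 g) j
      * sensitivity t (g (x.1.1.orderEmbOfFin rfl j)) :=
  sensitivity_succ _

theorem mean_tree_succ {α : Type*} [Fintype α] {w : α → ℝ} (hw : IsWeight w) {t : ℕ}
    (F : (TreeNode n (t + 1) → α) → ℝ) :
    mean (prodWeight (TreeNode n (t + 1)) w) F
      = mean w fun x => mean (prodWeight (Fin n) (prodWeight (TreeNode n t) w)) fun g =>
          F (graft x g) := by
  rw [← mean_prodWeight_comp hw (equivOption n t).symm.injective, mean_prodWeight_option]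
  congr 1
  funext x
  congr 1
  funext g
  congr 1
  funext p
  cases p <;> rfl

/-- The weight of a random rule together with a random initial state. -/
def entryWeight (n : ℕ) (D : PMF ℕ) (T : (d : ℕ) → PMF (BoolFun d)) : Entry n → ℝ :=
  fun q => ruleWeight n D T q.1 * (1 / 2)

theorem isWeight_half : IsWeight fun _ : Bool => (1 / 2 : ℝ) where
  nonneg _ := by norm_num
  sum_eq_one := by norm_num

theorem mean_entryWeight (D : PMF ℕ) (T : (d : ℕ) → PMF (BoolFun d)) (F : Entry n → ℝ) :
    mean (entryWeight n D T) F
      = mean (ruleWeight n D T) fun r => mean (fun _ : Bool => (1 / 2 : ℝ)) fun b => F (r, b) :=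
  mean_prod (ruleWeight n D T) (fun _ : Bool => (1 / 2 : ℝ)) F

theorem mean_entryWeight_fst (D : PMF ℕ) (T : (d : ℕ) → PMF (BoolFun d)) (F : NodeRule n → ℝ) :
    mean (entryWeight n D T) (fun q => F q.1) = mean (ruleWeight n D T) F := by
  rw [mean_entryWeight]
  simp only [isWeight_half.mean_const]

section

variable {K : ℕ} {D : PMF ℕ} {T : (d : ℕ) → PMF (BoolFun d)}

theorem isWeight_entryWeight (hK : K ≤ n) (hD : ∀ d ∈ D.support, 1 ≤ d ∧ d ≤ K) :
    IsWeight (entryWeight n D T) where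
  nonneg q := mul_nonneg ((isWeight_ruleWeight hK hD).nonneg _) (by norm_num)
  sum_eq_one := by
    have h := mean_entryWeight_fst (n := n) D T fun _ => 1
    rw [(isWeight_ruleWeight hK hD).mean_const] at h
    simpa [mean] using h

theorem card_le_of_entryWeight_ne_zero (hD : ∀ d ∈ D.support, 1 ≤ d ∧ d ≤ K) {q : Entry n}
    (h : entryWeight n D T q ≠ 0) : q.1.1.card ≤ K :=
  card_le_of_ruleWeight_ne_zero (D := D) (T := T) hD fun h0 => h (by simp [entryWeight, h0])

/-- The weight of an independent labelling of the tree by random entries. -/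
abbrev treeWeight (n t : ℕ) (D : PMF ℕ) (T : (d : ℕ) → PMF (BoolFun d)) :
    (TreeNode n t → Entry n) → ℝ :=
  prodWeight (TreeNode n t) (entryWeight n D T)

/-- Distinct in-neighbours have independent subtrees, so unbiased values make the input vector
uniform. -/
theorem mean_rootInputs {t : ℕ} (hK : K ≤ n) (hD : ∀ d ∈ D.support, 1 ≤ d ∧ d ≤ K)
    (hbal : ∀ b, mean (treeWeight n t D T) (fun ω => if treeValue t ω = b then 1 else 0) = 1 / 2)
    (S : Finset (Fin n)) (F : (Fin S.card → Bool) → ℝ) :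
    mean (prodWeight (Fin n) (treeWeight n t D T)) (fun g => F (rootInputs S g)) = 𝔼 z, F z := by
  have h1 := mean_prodWeight_comp (isWeight_prodWeight (isWeight_entryWeight (T := T) hK hD))
    (ι := Fin n) (κ := Fin S.card) (e := S.orderEmbOfFin rfl) (S.orderEmbOfFin rfl).injective
    fun h : Fin S.card → TreeNode n t → Entry n => F (treeValue t ∘ h)
  refine h1.trans ?_
  rw [mean_prodWeight_map _ (treeValue t) F]
  simp only [hbal]
  exact mean_half_eq_expect F

/-- Under balance on average, the values in the tree are unbiased. -/
theorem mean_treeValue (hK : K ≤ n) (hD : ∀ d ∈ D.support, 1 ≤ d ∧ d ≤ K)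
    (hT : BalancedOnAverage D T) : ∀ (t : ℕ) (b : Bool),
    mean (treeWeight n t D T) (fun ω => if treeValue t ω = b then 1 else 0) = 1 / 2
  | 0, b => by
    have hw := isWeight_entryWeight (T := T) hK hD
    refine (mean_tree_zero hw fun q => if q.2 = b then 1 else 0).trans ?_
    rw [mean_entryWeight]
    have : mean (fun _ : Bool => (1 / 2 : ℝ)) (fun c => if c = b then 1 else 0) = 1 / 2 := by
      simp [mean]
    simp only [this, (isWeight_ruleWeight hK hD).mean_const]
  | t + 1, b => by
    have hw := isWeight_entryWeight (n := n) (T := T) hK hD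
    have htrue : mean (treeWeight n (t + 1) D T)
        (fun ω => if treeValue (t + 1) ω = true then 1 else 0) = 1 / 2 := by
      rw [mean_tree_succ hw, ← hT.mean_output hK hD, ← mean_entryWeight_fst]
      congr 1
      funext q
      exact mean_rootInputs hK hD (mean_treeValue hK hD hT t) q.1.1
        fun z => if q.1.2 z = true then 1 else 0
    cases b
    · have : ∀ ω : TreeNode n (t + 1) → Entry n, (if treeValue (t + 1) ω = false then (1 : ℝ) else 0)
          = 1 - if treeValue (t + 1) ω = true then 1 else 0 := fun ω => by
        cases treeValue (t + 1) ω <;> simp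
      simp only [this, mean_sub, htrue, (isWeight_prodWeight hw).mean_const]
      norm_num
    · exact htrue

/-- Pivotality of `j` compares the two settings of bit `j`, so it ignores the present one. This is
the source of the independence in `mean_sensitivity`. -/
theorem pivotal_congr {d : ℕ} (f : BoolFun d) {z z' : Fin d → Bool} {j : Fin d}
    (h : ∀ k, k ≠ j → z' k = z k) : pivotal f z' j = pivotal f z j := by
  by_cases hj : z' j = z j
  · have : z' = z := by
      funext k
      by_cases hk : k = j
      · rw [hk, hj]
      · exact h k hk
    rw [this]
  · have h1 : z' = flip z j := by
      funext k
      by_cases hk : k = j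
      · subst hk
        revert hj
        simp only [flip, Function.update_self]
        cases z' k <;> cases z k <;> simp
      · rw [h k hk, flip, Function.update_of_ne hk]
    have h2 : flip z' j = z := by
      rw [h1]
      simp [flip]
    unfold pivotal
    rw [h2, ← h1]
    exact if_congr ne_comm rfl rfl

/-- Under full independence one averages over the function first, with the inputs fixed; their law,
possibly biased, is then irrelevant. Under balance one fixes the rule and averages over the inputs,
which are uniform. -/
theorem mean_pivotal (hK : K ≤ n) (hD : ∀ d ∈ D.support, 1 ≤ d ∧ d ≤ K)
    (hT : FullyIndependent D T ∨ BalancedOnAverage D T) (t : ℕ) :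
    mean (ruleWeight n D T) (fun r => mean (prodWeight (Fin n) (treeWeight n t D T)) fun g =>
      ∑ j, pivotal r.2 (rootInputs r.1 g) j) = networkInfluence K D T := by
  rw [← mean_ruleWeight_influence hK hD]
  rcases hT with hT | hT
  · rw [mean_ruleWeight_eq, mean_ruleWeight_eq]
    refine Finset.sum_congr rfl fun S _ => ?_
    by_cases hS : D S.card = 0
    · simp [hS]
    · congr 1
      rw [mean_comm]
      have h : ∀ g : Fin n → TreeNode n t → Entry n,
          mean (realWeight (T S.card)) (fun f => ∑ j, pivotal f (rootInputs S g) j)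
            = mean (realWeight (T S.card)) fun f => ∑ j, influence f j := fun g => by
        rw [mean_sum, mean_sum]
        exact Finset.sum_congr rfl fun j _ => hT.mean_pivotal hS _ j
      simp only [h]
      exact (isWeight_prodWeight (isWeight_prodWeight
        (isWeight_entryWeight (T := T) hK hD))).mean_const _
  · congr 1
    funext r
    rw [mean_sum]
    refine Finset.sum_congr rfl fun j _ => ?_
    exact mean_rootInputs hK hD (mean_treeValue hK hD hT t) r.1 fun z => pivotal r.2 z j

/-- The mean sensitivity of the tree. -/
theorem mean_sensitivity (hK : K ≤ n) (hD : ∀ d ∈ D.support, 1 ≤ d ∧ d ≤ K)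
    (hT : FullyIndependent D T ∨ BalancedOnAverage D T) : ∀ t : ℕ,
    mean (treeWeight n t D T) (sensitivity t) = networkInfluence K D T ^ t
  | 0 => by
    simp only [funext sensitivity_zero, pow_zero]
    exact (isWeight_prodWeight (isWeight_entryWeight hK hD)).mean_const 1
  | t + 1 => by
    have hw := isWeight_entryWeight (n := n) (T := T) hK hD
    rw [mean_tree_succ hw, pow_succ', ← mean_sensitivity hK hD hT t, ← mean_pivotal hK hD hT t,
      ← mean_entryWeight_fst, ← mean_mul_right]
    congr 1
    funext q
    simp only [sensitivity_graft]
    rw [mean_sum, mean_sum, Finset.sum_mul]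
    refine Finset.sum_congr rfl fun j _ => ?_
    -- Resampling the subtree at input `j` leaves the pivotality of `j` unchanged, so the mean of
    -- the product factors.
    refine mean_prodWeight_mul (isWeight_prodWeight hw) (q.1.1.orderEmbOfFin rfl j)
      (fun g => pivotal q.1.2 (rootInputs q.1.1 g) j) (fun g x => ?_) (sensitivity t)
    refine pivotal_congr _ fun k hk => ?_
    unfold rootInputs
    rw [Function.update_of_ne fun h => hk ((q.1.1.orderEmbOfFin rfl).injective h)]

open Classical in
/-- The number of reached nodes of the tree that stand for `c`, if the root stands for `a`. -/
def visits (t : ℕ) (a : Fin n) (ω : TreeNode n t → Entry n) (c : Fin n × Bool) : ℕ :=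
  ∑ p, if Reached t ω p ∧ place t a p = c then 1 else 0

theorem visits_zero (a : Fin n) (ω : TreeNode n 0 → Entry n) (c : Fin n × Bool) :
    visits 0 a ω c = if (a, true) = c then 1 else 0 := by
  classical
  unfold visits
  rw [sum_zero]
  simp [Reached, place]

theorem visits_succ {t : ℕ} (a : Fin n) (ω : TreeNode n (t + 1) → Entry n) (c : Fin n × Bool) :
    visits (t + 1) a ω c
      = (if (a, false) = c then 1 else 0)
        + ∑ u ∈ (ω root).1.1, visits t u (subtree ω u) c := by
  classical
  unfold visits
  rw [sum_succ]
  congr 1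
  · simp [Reached, place]
  · rw [← Finset.sum_subset (Finset.subset_univ (ω root).1.1)]
    · refine Finset.sum_congr rfl fun u hu => Finset.sum_congr rfl fun p _ => ?_
      simp [Reached, place, hu]
    · intro u _ hu
      simp [Reached, hu]

/-- The number of ordered pairs of distinct reached nodes of the tree that stand for the same node
of the network. -/
def collisions (t : ℕ) (a : Fin n) (ω : TreeNode n t → Entry n) : ℝ :=
  ∑ c, ((visits t a ω c : ℝ) ^ 2 - visits t a ω c)

theorem two_le_collisions {t : ℕ} {a : Fin n} {ω : TreeNode n t → Entry n}
    (h : ¬ Set.InjOn (place t a) (reachedSet t ω)) : 2 ≤ collisions t a ω := by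
  classical
  simp only [Set.InjOn] at h
  push Not at h
  obtain ⟨p, hp, q, hq, hpq, hne⟩ := h
  have hp' := mem_reachedSet.1 hp
  have hq' := mem_reachedSet.1 hq
  have h2 : 2 ≤ visits t a ω (place t a p) := by
    have : ∑ r ∈ {p, q}, (if Reached t ω r ∧ place t a r = place t a p then 1 else 0)
        ≤ visits t a ω (place t a p) :=
      Finset.sum_le_sum_of_subset (Finset.subset_univ _)
    rw [Finset.sum_pair hne] at this
    simpa [hp', hq', hpq] using this
  have hnn : ∀ c ∈ Finset.univ, 0 ≤ (visits t a ω c : ℝ) ^ 2 - visits t a ω c := by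
    intro c _
    rw [sub_nonneg]
    exact_mod_cast Nat.le_self_pow two_ne_zero _
  refine le_trans ?_ (Finset.single_le_sum hnn (Finset.mem_univ (place t a p)))
  have : (2 : ℝ) ≤ visits t a ω (place t a p) := by exact_mod_cast h2
  nlinarith

theorem collisions_nonneg (t : ℕ) (a : Fin n) (ω : TreeNode n t → Entry n) :
    0 ≤ collisions t a ω := by
  refine Finset.sum_nonneg fun c _ => ?_
  rw [sub_nonneg]
  exact_mod_cast Nat.le_self_pow two_ne_zero _

theorem collisions_zero (a : Fin n) (ω : TreeNode n 0 → Entry n) : collisions 0 a ω = 0 := by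
  refine Finset.sum_eq_zero fun c _ => ?_
  rw [visits_zero]
  split_ifs <;> simp

/-- Expanding the square sorts the pairs: root with a node below it (twice, as pairs are ordered),
both in one subtree, or in two different subtrees. -/
theorem collisions_succ {t : ℕ} (a : Fin n) (ω : TreeNode n (t + 1) → Entry n) :
    collisions (t + 1) a ω
      = 2 * ∑ u ∈ (ω root).1.1, (visits t u (subtree ω u) (a, false) : ℝ)
        + ∑ u ∈ (ω root).1.1, (collisions t u (subtree ω u)
          + ∑ v ∈ (ω root).1.1.erase u, ∑ c,
              (visits t u (subtree ω u) c : ℝ) * visits t v (subtree ω v) c) := by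
  set S := (ω root).1.1
  set V : Fin n → Fin n × Bool → ℝ := fun u c => visits t u (subtree ω u) c with hV
  have h1 : ∀ c, (visits (t + 1) a ω c : ℝ) ^ 2 - visits (t + 1) a ω c
      = (if (a, false) = c then 2 * ∑ u ∈ S, V u c else 0)
        + ((∑ u ∈ S, V u c) ^ 2 - ∑ u ∈ S, V u c) := by
    intro c
    rw [visits_succ]
    push_cast
    split_ifs <;> simp only [hV] <;> ring
  have h2 : ∀ c, (∑ u ∈ S, V u c) ^ 2 - ∑ u ∈ S, V u c
      = ∑ u ∈ S, ((V u c ^ 2 - V u c) + ∑ v ∈ S.erase u, V u c * V v c) := by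
    intro c
    rw [sq, Finset.sum_mul, ← Finset.sum_sub_distrib]
    refine Finset.sum_congr rfl fun u hu => ?_
    rw [← Finset.mul_sum, ← Finset.add_sum_erase S (fun v => V v c) hu]
    ring
  unfold collisions
  simp only [h1, h2, Finset.sum_add_distrib]
  rw [Finset.sum_comm (s := (Finset.univ : Finset (Fin n × Bool))) (t := S)]
  congr 1
  · simp [hV]
  · congr 1
    rw [Finset.sum_comm]
    exact Finset.sum_congr rfl fun u _ => Finset.sum_comm

/-- The number of inner nodes of the complete `K`-ary tree of depth `t`. -/
def innerNodes (K t : ℕ) : ℕ := ∑ i ∈ Finset.range t, K ^ i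

theorem innerNodes_succ (K t : ℕ) : innerNodes K (t + 1) = 1 + K * innerNodes K t := by
  unfold innerNodes
  rw [geom_sum_succ, add_comm]

theorem innerNodes_le {K : ℕ} (hK : 2 ≤ K) (t : ℕ) : innerNodes K t ≤ K ^ t :=
  (Nat.geomSum_lt hK fun _ hi => Finset.mem_range.1 hi).le

/-- The mean number of visits. -/
def meanVisits (n t : ℕ) (D : PMF ℕ) (T : (d : ℕ) → PMF (BoolFun d)) (a : Fin n)
    (c : Fin n × Bool) : ℝ :=
  mean (treeWeight n t D T) fun ω => (visits t a ω c : ℝ)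

theorem meanVisits_nonneg (hK : K ≤ n) (hD : ∀ d ∈ D.support, 1 ≤ d ∧ d ≤ K) (t : ℕ) (a : Fin n)
    (c : Fin n × Bool) : 0 ≤ meanVisits n t D T a c :=
  (isWeight_prodWeight (isWeight_entryWeight hK hD)).mean_nonneg fun _ => Nat.cast_nonneg _

theorem meanVisits_zero (hK : K ≤ n) (hD : ∀ d ∈ D.support, 1 ≤ d ∧ d ≤ K) (a : Fin n)
    (c : Fin n × Bool) : meanVisits n 0 D T a c = if (a, true) = c then 1 else 0 := by
  unfold meanVisits
  simp only [visits_zero]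
  rw [(isWeight_prodWeight (isWeight_entryWeight hK hD)).mean_const]
  push_cast
  rfl

/-- Each node is an in-neighbour of the root with probability at most `K / n`, independently of what
its subtree visits. -/
theorem meanVisits_succ_le (hK : K ≤ n) (hD : ∀ d ∈ D.support, 1 ≤ d ∧ d ≤ K) (t : ℕ) (a : Fin n)
    (c : Fin n × Bool) : meanVisits n (t + 1) D T a c
      ≤ (if (a, false) = c then 1 else 0) + K / n * ∑ u, meanVisits n t D T u c := by
  have hw := isWeight_entryWeight (n := n) (T := T) hK hD
  unfold meanVisits
  rw [mean_tree_succ hw]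
  simp only [visits_succ, graft_root, subtree_graft]
  push_cast
  simp only [mean_add, (isWeight_prodWeight (isWeight_prodWeight hw)).mean_const, hw.mean_const]
  refine add_le_add_right ?_ _
  refine le_of_eq_of_le ?_ (mean_ruleWeight_sum_le hK hD (meanVisits_nonneg hK hD t · c) (T := T))
  rw [← mean_entryWeight_fst]
  congr 1
  funext q
  rw [mean_sum]
  refine Finset.sum_congr rfl fun u _ => ?_
  exact mean_prodWeight_apply (isWeight_prodWeight hw) u fun ω => (visits t u ω c : ℝ)

/-- The bound for one start involves the sum over all starts; summing over the `n` starts closes the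
recursion, with growth factor `K`. -/
theorem sum_meanVisits_le (hK0 : 0 < K) (hK : K ≤ n) (hD : ∀ d ∈ D.support, 1 ≤ d ∧ d ≤ K) :
    ∀ (t : ℕ) (b : Fin n), ∑ u, meanVisits n t D T u (b, true) ≤ (K : ℝ) ^ t ∧
      ∑ u, meanVisits n t D T u (b, false) ≤ innerNodes K t
  | 0, b => by
    simp [meanVisits_zero hK hD, innerNodes]
  | t + 1, b => by
    have hn : (n : ℝ) ≠ 0 := by
      have : n ≠ 0 := by omega
      exact_mod_cast this
    obtain ⟨h1, h2⟩ := sum_meanVisits_le hK0 hK hD t b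
    constructor
    · calc _ ≤ ∑ _u : Fin n, K / n * (K : ℝ) ^ t := by
            refine Finset.sum_le_sum fun u _ => ?_
            refine (meanVisits_succ_le hK hD t u _).trans ?_
            simp only [Prod.mk.injEq, Bool.false_eq_true, and_false, if_false, zero_add]
            gcongr
        _ = (K : ℝ) ^ (t + 1) := by
            simp
            field_simp
            ring
    · calc _ ≤ ∑ u : Fin n, ((if u = b then 1 else 0) + K / n * (innerNodes K t : ℝ)) := by
            refine Finset.sum_le_sum fun u _ => ?_
            refine (meanVisits_succ_le hK hD t u _).trans ?_
            simp only [Prod.mk.injEq, and_true]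
            gcongr
        _ = innerNodes K (t + 1) := by
            rw [Finset.sum_add_distrib, innerNodes_succ]
            simp
            field_simp

/-- This bounds the expected coincidences between two sibling subtrees as if each pair of inner
nodes and each pair of leaves met with probability `1 / n`. The roots cannot meet since `a ≠ a'`, so
the product of the two indicators drops out. -/
theorem sum_meanVisits_mul_le (hK0 : 0 < K) (hK : K ≤ n) (hD : ∀ d ∈ D.support, 1 ≤ d ∧ d ≤ K)
    (t : ℕ) {a a' : Fin n} (h : a ≠ a') :
    ∑ c, meanVisits n t D T a c * meanVisits n t D T a' c
      ≤ ((innerNodes K t : ℝ) ^ 2 + ((K : ℝ) ^ t) ^ 2) / n := by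
  have hn : (0 : ℝ) < n := by
    have : 0 < n := by omega
    exact_mod_cast this
  cases t with
  | zero =>
    rw [Finset.sum_eq_zero]
    · positivity
    · intro c _
      rw [meanVisits_zero hK hD, meanVisits_zero hK hD]
      by_cases hc : (a, true) = c
      · rw [if_neg (c := (a', true) = c), mul_zero]
        rintro rfl
        exact h (congrArg Prod.fst hc)
      · rw [if_neg hc, zero_mul]
  | succ t =>
    have hle : ∀ a b, meanVisits n (t + 1) D T a (b, true) ≤ K / n * (K : ℝ) ^ t := fun a b => by
      refine (meanVisits_succ_le hK hD t a _).trans ?_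
      simp only [Prod.mk.injEq, Bool.false_eq_true, and_false, if_false, zero_add]
      exact mul_le_mul_of_nonneg_left (sum_meanVisits_le hK0 hK hD t b).1 (by positivity)
    have hle' : ∀ a b, meanVisits n (t + 1) D T a (b, false)
        ≤ (if a = b then 1 else 0) + K / n * (innerNodes K t : ℝ) := fun a b => by
      refine (meanVisits_succ_le hK hD t a _).trans ?_
      simp only [Prod.mk.injEq, and_true]
      exact add_le_add_right
        (mul_le_mul_of_nonneg_left (sum_meanVisits_le hK0 hK hD t b).2 (by positivity)) _
    rw [Fintype.sum_prod_type]
    simp only [Fintype.sum_bool, Finset.sum_add_distrib]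
    have h1 : ∑ b, meanVisits n (t + 1) D T a (b, true) * meanVisits n (t + 1) D T a' (b, true)
        ≤ ((K : ℝ) ^ (t + 1)) ^ 2 / n := by
      calc _ ≤ ∑ _b : Fin n, (K / n * (K : ℝ) ^ t) * (K / n * (K : ℝ) ^ t) :=
            Finset.sum_le_sum fun b _ => mul_le_mul (hle a b) (hle a' b)
              (meanVisits_nonneg hK hD _ _ _) (by positivity)
        _ = _ := by
            simp
            field_simp
            ring
    have h2 : ∑ b, meanVisits n (t + 1) D T a (b, false) * meanVisits n (t + 1) D T a' (b, false)
        ≤ (innerNodes K (t + 1) : ℝ) ^ 2 / n := by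
      set ρ : ℝ := K / n * (innerNodes K t : ℝ) with hρ
      have hρ0 : 0 ≤ ρ := by positivity
      calc _ ≤ ∑ b : Fin n, ((if a = b then 1 else 0) + ρ) * ((if a' = b then 1 else 0) + ρ) :=
            Finset.sum_le_sum fun b _ => mul_le_mul (hle' a b) (hle' a' b)
              (meanVisits_nonneg hK hD _ _ _) (by split_ifs <;> positivity)
        _ = 2 * ρ + n * ρ ^ 2 := by
            have : ∀ b, ((if a = b then 1 else 0) + ρ) * ((if a' = b then 1 else 0) + ρ)
                = (if a = b then ρ else 0) + (if a' = b then ρ else 0) + ρ ^ 2 := by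
              intro b
              split_ifs with h1 h2
              · exact absurd (h1.trans h2.symm) h
              all_goals ring
            simp only [this, Finset.sum_add_distrib]
            simp
            ring
        _ ≤ _ := by
            rw [innerNodes_succ, hρ, le_div_iff₀ hn]
            push_cast
            have : (2 * (K / n * (innerNodes K t : ℝ)) + n * (K / n * (innerNodes K t : ℝ)) ^ 2) * n
                = 2 * (K * innerNodes K t) + (K * innerNodes K t : ℝ) ^ 2 := by
              field_simp
            rw [this]
            nlinarith
    rw [add_comm, add_div]
    · exact add_le_add h2 h1

/-- The numerator counts the ordered pairs of distinct inner nodes and of distinct leaves in the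
complete `K`-ary tree; this count satisfies the recursion from `collisions_succ` with equality. -/
theorem mean_collisions_le (hK0 : 0 < K) (hK : K ≤ n) (hD : ∀ d ∈ D.support, 1 ≤ d ∧ d ≤ K) :
    ∀ (t : ℕ) (a : Fin n), mean (treeWeight n t D T) (collisions t a)
      ≤ ((innerNodes K t : ℝ) ^ 2 - innerNodes K t + ((K : ℝ) ^ t) ^ 2 - (K : ℝ) ^ t) / n
  | 0, a => by
    simp [funext (collisions_zero a), mean, innerNodes]
  | t + 1, a => by
    have hw := isWeight_entryWeight (n := n) (T := T) hK hD
    have hw' := isWeight_prodWeight (ι := TreeNode n t) hw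
    have hn : (0 : ℝ) < n := by
      have : 0 < n := by omega
      exact_mod_cast this
    set U : ℝ := ((innerNodes K t : ℝ) ^ 2 - innerNodes K t + ((K : ℝ) ^ t) ^ 2 - (K : ℝ) ^ t) / n
      with hU
    set X : ℝ := ((innerNodes K t : ℝ) ^ 2 + ((K : ℝ) ^ t) ^ 2) / n with hX
    have hX0 : 0 ≤ X := by positivity
    -- The induction hypothesis bounds a nonnegative mean by `U`. The sign is needed to replace the
    -- indegree of the root by `K`.
    have hU0 : 0 ≤ U :=
      (hw'.mean_nonneg fun ω => collisions_nonneg t a ω).trans (mean_collisions_le hK0 hK hD t a)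
    rw [mean_tree_succ hw]
    simp only [collisions_succ, graft_root, subtree_graft]
    have hstep : ∀ q : Entry n, entryWeight n D T q ≠ 0 →
        mean (prodWeight (Fin n) (treeWeight n t D T)) (fun g =>
          2 * ∑ u ∈ q.1.1, (visits t u (g u) (a, false) : ℝ)
            + ∑ u ∈ q.1.1, (collisions t u (g u)
              + ∑ v ∈ q.1.1.erase u, ∑ c, (visits t u (g u) c : ℝ) * visits t v (g v) c))
          ≤ 2 * ∑ u ∈ q.1.1, meanVisits n t D T u (a, false) + K * (U + (K - 1) * X) := by
      intro q hq
      have hcard : (q.1.1.card : ℝ) ≤ K := by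
        exact_mod_cast card_le_of_entryWeight_ne_zero hD hq
      rw [mean_add, mean_mul_left, mean_sum, mean_sum]
      refine add_le_add (le_of_eq ?_) ?_
      · congr 1
        exact Finset.sum_congr rfl fun u _ => mean_prodWeight_apply hw' u
          fun ω => (visits t u ω (a, false) : ℝ)
      · calc _ ≤ ∑ u ∈ q.1.1, (U + (q.1.1.card - 1 : ℝ) * X) := by
              refine Finset.sum_le_sum fun u hu => ?_
              rw [mean_add, mean_sum]
              refine add_le_add ?_ ?_
              · rw [mean_prodWeight_apply hw' u]
                exact mean_collisions_le hK0 hK hD t u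
              · calc _ ≤ ∑ v ∈ q.1.1.erase u, X := by
                      refine Finset.sum_le_sum fun v hv => ?_
                      have huv := (Finset.ne_of_mem_erase hv).symm
                      rw [mean_sum]
                      refine le_of_eq_of_le ?_ (sum_meanVisits_mul_le hK0 hK hD t huv (T := T))
                      exact Finset.sum_congr rfl fun c _ => mean_prodWeight_apply_mul hw' huv
                        (fun ω => (visits t u ω c : ℝ)) fun ω => (visits t v ω c : ℝ)
                  _ = _ := by
                      rw [Finset.sum_const, Finset.card_erase_of_mem hu, nsmul_eq_mul,
                        Nat.cast_pred (Finset.card_pos.2 ⟨u, hu⟩)]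
          _ = (q.1.1.card : ℝ) * (U + (q.1.1.card - 1 : ℝ) * X) := by
              rw [Finset.sum_const, nsmul_eq_mul]
          _ ≤ _ := by
              have hK1 : (1 : ℝ) ≤ K := by exact_mod_cast hK0
              have h1 : (q.1.1.card : ℝ) * (U + (q.1.1.card - 1 : ℝ) * X)
                  ≤ q.1.1.card * (U + (K - 1) * X) := by gcongr
              refine h1.trans (mul_le_mul_of_nonneg_right hcard ?_)
              have : 0 ≤ (K - 1) * X := mul_nonneg (by linarith) hX0
              linarith
    refine (hw.mean_mono hstep).trans ?_
    rw [mean_add, hw.mean_const, mean_mul_left, mean_entryWeight_fst D T fun r =>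
      ∑ u ∈ r.1, meanVisits n t D T u (a, false)]
    have h1 : mean (ruleWeight n D T) (fun r => ∑ u ∈ r.1, meanVisits n t D T u (a, false))
        ≤ K / n * innerNodes K t :=
      (mean_ruleWeight_sum_le hK hD fun u => meanVisits_nonneg hK hD t u _).trans
        (mul_le_mul_of_nonneg_left (sum_meanVisits_le hK0 hK hD t a).2 (by positivity))
    calc _ ≤ 2 * (K / n * (innerNodes K t : ℝ)) + K * (U + (K - 1) * X) := by gcongr
      _ = _ := by
        rw [hU, hX, innerNodes_succ]
        push_cast
        field_simp
        ring

open Classical in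
/-- The probability that two reached nodes of the tree stand for the same node of the network. -/
theorem mean_not_injOn_le (hK2 : 2 ≤ K) (hK : K ≤ n) (hD : ∀ d ∈ D.support, 1 ≤ d ∧ d ≤ K)
    (t : ℕ) (a : Fin n) :
    mean (treeWeight n t D T)
      (fun ω => if Set.InjOn (place t a) (reachedSet t ω) then 0 else 1)
      ≤ ((K : ℝ) ^ t) ^ 2 / n := by
  have hw := isWeight_prodWeight (ι := TreeNode n t) (isWeight_entryWeight (n := n) (T := T) hK hD)
  have h1 : mean (treeWeight n t D T)
      (fun ω => if Set.InjOn (place t a) (reachedSet t ω) then 0 else 1)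
      -- Pairs are ordered, so a failure of injectivity counts at least twice; the resulting `1 / 2`
      -- absorbs the factor from bounding inner nodes and leaves by `K ^ t` each.
      ≤ mean (treeWeight n t D T) fun ω => 1 / 2 * collisions t a ω := by
    refine hw.mean_mono fun ω _ => ?_
    split_ifs with h
    · have := collisions_nonneg t a ω
      positivity
    · have := two_le_collisions h
      linarith
  rw [mean_mul_left] at h1
  have h2 := mean_collisions_le (T := T) (by omega) hK hD t a
  have h3 : (innerNodes K t : ℝ) ≤ (K : ℝ) ^ t := by exact_mod_cast innerNodes_le hK2 t
  have h4 : ((innerNodes K t : ℝ) ^ 2 - innerNodes K t + ((K : ℝ) ^ t) ^ 2 - (K : ℝ) ^ t) / n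
      ≤ (2 * ((K : ℝ) ^ t) ^ 2) / n := by
    have h5 : (innerNodes K t : ℝ) ^ 2 ≤ ((K : ℝ) ^ t) ^ 2 := by gcongr
    have h6 : (0 : ℝ) ≤ innerNodes K t := Nat.cast_nonneg _
    have h7 : (0 : ℝ) ≤ (K : ℝ) ^ t := by positivity
    gcongr
    linarith
  rw [mul_div_assoc] at h4
  linarith

end

end

end RBN

/-! ### Comparison of the network with the tree, and the passage to Hamming distances. -/

namespace RBN

noncomputable section

open TreeNode

variable {n K : ℕ} {D : PMF ℕ} {T : (d : ℕ) → PMF (BoolFun d)}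

open Classical in
/-- The mean sensitivity of the random network is close to that of the tree. -/
theorem abs_mean_networkSensitivity_sub_le (hK2 : 2 ≤ K) (hK : K ≤ n)
    (hD : ∀ d ∈ D.support, 1 ≤ d ∧ d ≤ K)
    (hT : FullyIndependent D T ∨ BalancedOnAverage D T) (t : ℕ) (a : Fin n) :
    |mean (prodWeight (Fin n × Bool) (entryWeight n D T)) (networkSensitivity t a)
      - networkInfluence K D T ^ t| ≤ ((K : ℝ) ^ t) ^ 3 / n := by
  have hw := isWeight_entryWeight (n := n) (T := T) hK hD
  have hwJ := isWeight_prodWeight (ι := Fin n × Bool) hw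
  have hwI := isWeight_prodWeight (ι := TreeNode n t) hw
  rw [← mean_sensitivity hK hD hT t]
  have hgood := mean_exploration hw (place t a) (reachedSet t)
    (fun ω ω' h => reachedSet_congr h) (sensitivity t) fun ω ω' h => sensitivity_congr h
  have hprob := mean_exploration hw (place t a) (reachedSet t)
    (fun ω ω' h => reachedSet_congr h) (fun _ => 1) fun ω ω' h => rfl
  set PI : ℝ := mean (treeWeight n t D T)
    (fun ω => if Set.InjOn (place t a) (reachedSet t ω) then 0 else 1) with hPI
  have hPI' : PI ≤ ((K : ℝ) ^ t) ^ 2 / n := mean_not_injOn_le hK2 hK hD t a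
  have hsplit : ∀ (p : Prop) [Decidable p] (x : ℝ), x = (if p then x else 0) + if p then 0 else x := by
    intro p _ x
    split_ifs <;> simp
  have hnot : ∀ (p : Prop) [Decidable p], (if p then (0 : ℝ) else 1) = 1 - if p then 1 else 0 := by
    intro p _
    split_ifs <;> simp
  have hPJ : mean (prodWeight (Fin n × Bool) (entryWeight n D T))
      (fun ρ => if Set.InjOn (place t a) (reachedSet t (ρ ∘ place t a)) then 0 else 1) = PI := by
    simp only [hPI, hnot, mean_sub, hwI.mean_const, hwJ.mean_const, hprob]
  have hJ : mean (prodWeight (Fin n × Bool) (entryWeight n D T)) (networkSensitivity t a)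
      = mean (treeWeight n t D T)
          (fun ω => if Set.InjOn (place t a) (reachedSet t ω) then sensitivity t ω else 0)
        + mean (prodWeight (Fin n × Bool) (entryWeight n D T)) (fun ρ =>
          if Set.InjOn (place t a) (reachedSet t (ρ ∘ place t a)) then 0
          else networkSensitivity t a ρ) := by
    rw [← hgood, ← mean_add]
    refine congrArg (mean _) (funext fun ρ => ?_)
    split_ifs with h
    · rw [networkSensitivity_eq h, add_zero]
    · rw [zero_add]
  have hI : mean (treeWeight n t D T) (sensitivity t)
      = mean (treeWeight n t D T)
          (fun ω => if Set.InjOn (place t a) (reachedSet t ω) then sensitivity t ω else 0)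
        + mean (treeWeight n t D T) (fun ω =>
          if Set.InjOn (place t a) (reachedSet t ω) then 0 else sensitivity t ω) := by
    rw [← mean_add]
    exact congrArg (mean _) (funext fun ω => hsplit _ _)
  have hbound : (K : ℝ) ^ t * PI ≤ ((K : ℝ) ^ t) ^ 3 / n := by
    calc (K : ℝ) ^ t * PI ≤ (K : ℝ) ^ t * (((K : ℝ) ^ t) ^ 2 / n) := by gcongr
      _ = _ := by ring
  have hJ0 : 0 ≤ mean (prodWeight (Fin n × Bool) (entryWeight n D T)) (fun ρ =>
      if Set.InjOn (place t a) (reachedSet t (ρ ∘ place t a)) then 0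
      else networkSensitivity t a ρ) := by
    refine hwJ.mean_nonneg fun ρ => ?_
    split_ifs
    · exact le_rfl
    · exact networkSensitivity_nonneg t a ρ
  have hI0 : 0 ≤ mean (treeWeight n t D T) (fun ω =>
      if Set.InjOn (place t a) (reachedSet t ω) then 0 else sensitivity t ω) := by
    refine hwI.mean_nonneg fun ω => ?_
    split_ifs
    · exact le_rfl
    · exact sensitivity_nonneg t ω
  have hJ1 : mean (prodWeight (Fin n × Bool) (entryWeight n D T)) (fun ρ =>
      if Set.InjOn (place t a) (reachedSet t (ρ ∘ place t a)) then 0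
      else networkSensitivity t a ρ) ≤ (K : ℝ) ^ t * PI := by
    rw [← hPJ, ← mean_mul_left]
    refine hwJ.mean_mono fun ρ hρ => ?_
    split_ifs
    · simp
    · rw [mul_one]
      exact networkSensitivity_le
        (fun c => card_le_of_entryWeight_ne_zero hD (prodWeight_ne_zero hρ c)) t a
  have hI1 : mean (treeWeight n t D T) (fun ω =>
      if Set.InjOn (place t a) (reachedSet t ω) then 0 else sensitivity t ω)
      ≤ (K : ℝ) ^ t * PI := by
    rw [hPI, ← mean_mul_left]
    refine hwI.mean_mono fun ω hω => ?_
    split_ifs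
    · simp
    · rw [mul_one]
      exact sensitivity_le fun p => card_le_of_entryWeight_ne_zero hD (prodWeight_ne_zero hω p)
  -- The contributions of the good event cancel; the two remainders both lie in `[0, K ^ t * PI]`,
  -- so no factor 2 is lost.
  rw [hJ, hI, abs_le]
  constructor <;> linarith

/-- The network and the initial state that a family of entries specifies. -/
theorem mean_network_state (hK : K ≤ n) (hD : ∀ d ∈ D.support, 1 ≤ d ∧ d ≤ K)
    (F : Network n → (Fin n → Bool) → ℝ) :
    mean (prodWeight (Fin n × Bool) (entryWeight n D T))
        (fun ρ => F (fun u => (ρ (u, false)).1) fun u => (ρ (u, true)).2)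
      = mean (prodWeight (Fin n) (ruleWeight n D T)) fun N => 𝔼 x, F N x := by
  have hr := isWeight_ruleWeight (n := n) (T := T) hK hD
  refine (mean_prodWeight_prod (ι := Fin n × Bool) (ruleWeight n D T) (fun _ : Bool => 1 / 2)
    fun ρ => F (fun u => (ρ (u, false)).1) fun u => (ρ (u, true)).2).trans ?_
  have h1 := mean_prodWeight_comp hr (ι := Fin n × Bool) (e := fun u : Fin n => (u, false))
    (fun u v h => congrArg Prod.fst h) fun N => 𝔼 x, F N x
  rw [← h1]
  congr 1
  funext N
  have h2 := mean_prodWeight_comp isWeight_half (ι := Fin n × Bool) (e := fun u : Fin n => (u, true))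
    (fun u v h => congrArg Prod.fst h) fun x => F (N ∘ fun u : Fin n => (u, false)) x
  exact h2.trans (mean_half_eq_expect _)

theorem realWeight_randomNetwork (hD : ∀ d ∈ D.support, d ≤ n) :
    realWeight (randomNetwork n D T hD) = prodWeight (Fin n) (ruleWeight n D T) := by
  funext N
  rw [← realWeight_randomRule D T hD]
  simp [realWeight, prodWeight, randomNetwork, iidLaw, ENNReal.toReal_prod]

/-- The sensitivity counts the initial perturbations that reach a node. -/
theorem networkSensitivity_eq_sum (t : ℕ) (a : Fin n) (ρ : Fin n × Bool → Entry n) :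
    networkSensitivity t a ρ = ∑ i, if
      stateAt (fun u => (ρ (u, false)).1) t (flip (fun u => (ρ (u, true)).2) i) a
        ≠ stateAt (fun u => (ρ (u, false)).1) t (fun u => (ρ (u, true)).2) a then 1 else 0 := by
  unfold networkSensitivity
  rw [Fintype.sum_prod_type]
  refine Finset.sum_congr rfl fun i _ => ?_
  simp only [treeValue_place, flipBit_fst, Fintype.sum_bool]
  have h1 : (fun u => (flipBit ρ (i, true) (u, true)).2) = flip (fun u => (ρ (u, true)).2) i := by
    funext u
    by_cases h : u = i
    · subst h
      rw [flipBit_self]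
      simp [flip]
    · rw [flipBit_of_ne ρ (by simpa using h)]
      simp [flip, h]
  -- Flips at inner places change no initial state and contribute nothing.
  have h2 : (fun u => (flipBit ρ (i, false) (u, true)).2) = fun u => (ρ (u, true)).2 := by
    funext u
    rw [flipBit_of_ne ρ (by simp)]
  rw [h1, h2]
  simp

/-- The expected distance as an average of mean sensitivities. -/
theorem expectation_avgInfluence (hK : K ≤ n) (hD : ∀ d ∈ D.support, 1 ≤ d ∧ d ≤ K) (t : ℕ)
    (hD' : ∀ d ∈ D.support, d ≤ n) :
    expectation (randomNetwork n D T hD') (fun N => avgInfluence N t)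
      = 𝔼 a, mean (prodWeight (Fin n × Bool) (entryWeight n D T)) (networkSensitivity t a) := by
  have h : ∀ a, mean (prodWeight (Fin n × Bool) (entryWeight n D T)) (networkSensitivity t a)
      = mean (prodWeight (Fin n) (ruleWeight n D T)) fun N => 𝔼 x, ∑ i,
        if stateAt N t (flip x i) a ≠ stateAt N t x a then (1 : ℝ) else 0 := fun a => by
    rw [← mean_network_state hK hD]
    exact congrArg (mean _) (funext fun ρ => networkSensitivity_eq_sum t a ρ)
  simp only [h]
  rw [expectation_eq_mean, realWeight_randomNetwork, Fintype.expect_eq_sum_div_card,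
    ← mean_sum, div_eq_mul_inv, ← mean_mul_right]
  congr 1
  funext N
  have hdist : ∀ x y : Fin n → Bool, (hammingDist x y : ℝ) = ∑ a, if y a ≠ x a then 1 else 0 := by
    intro x y
    rw [hammingDist, Finset.card_filter]
    push_cast
    exact Finset.sum_congr rfl fun a _ => if_congr ne_comm rfl rfl
  unfold avgInfluence
  simp only [hdist]
  -- The factor `1 / n` from averaging over the perturbed bit becomes that of the average over the
  -- observed node.
  rw [Fintype.expect_eq_sum_div_card, div_eq_mul_inv]
  congr 1
  simp only [Fintype.expect_eq_sum_div_card, ← Finset.sum_div]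
  congr 1
  rw [Finset.sum_comm, Finset.sum_comm (s := (Finset.univ : Finset (Fin n)))]
  exact Finset.sum_congr rfl fun x _ => Finset.sum_comm

/-- With `y = n ^ (1/4)`, the hypothesis on `t` reads `K ^ t ≤ y`, so the left side is at most `y ^
3 / y ^ 4`. -/
theorem pow_three_div_le (hK2 : 2 ≤ K) (hK : K ≤ n) {t : ℕ}
    (ht : (t : ℝ) ≤ Real.log n / (4 * Real.log K)) :
    ((K : ℝ) ^ t) ^ 3 / n ≤ 1 / (n : ℝ) ^ (1 / 4 : ℝ) := by
  have hK1 : (1 : ℝ) < K := by exact_mod_cast (by omega : 1 < K)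
  have hn : (0 : ℝ) < n := by exact_mod_cast (by omega : 0 < n)
  have hlog : 0 < Real.log K := Real.log_pos hK1
  set y : ℝ := (n : ℝ) ^ (1 / 4 : ℝ) with hy
  have hy0 : 0 < y := Real.rpow_pos_of_pos hn _
  have hy4 : y ^ 4 = n := by
    rw [hy, ← Real.rpow_natCast, ← Real.rpow_mul hn.le]
    norm_num
  have hKy : (K : ℝ) ^ t ≤ y := by
    rw [← Real.log_le_log_iff (by positivity) hy0, Real.log_pow, hy, Real.log_rpow hn]
    rw [le_div_iff₀ (by positivity)] at ht
    linarith
  rw [← hy4, div_le_div_iff₀ (by positivity) hy0, one_mul]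
  calc ((K : ℝ) ^ t) ^ 3 * y ≤ y ^ 3 * y := by gcongr
    _ = y ^ 4 := by ring

end

end RBN

theorem theorem1 (n Kmax : ℕ) (hK : 2 ≤ Kmax) (hKn : Kmax ≤ n)
    (D : PMF ℕ) (hD : ∀ d ∈ D.support, 1 ≤ d ∧ d ≤ Kmax)
    (T : (d : ℕ) → PMF (RBN.BoolFun d))
    (hT : RBN.FullyIndependent D T ∨ RBN.BalancedOnAverage D T)
    (t : ℕ) (ht : (t : ℝ) ≤ Real.log n / (4 * Real.log Kmax)) :
    |RBN.expectation
        (RBN.randomNetwork n D T fun d hd => (hD d hd).2.trans hKn)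
        (fun N => RBN.avgInfluence N t)
      - RBN.networkInfluence Kmax D T ^ t| ≤ 1 / (n : ℝ) ^ (1 / 4 : ℝ) := by
  have hn : (0 : ℝ) < n := by exact_mod_cast (by omega : 0 < n)
  refine le_trans ?_ (RBN.pow_three_div_le hK hKn ht)
  rw [RBN.expectation_avgInfluence hKn hD, Fintype.expect_eq_sum_div_card, Fintype.card_fin,
    div_sub' hn.ne', abs_div, abs_of_pos hn, div_le_iff₀ hn]
  calc _ = |∑ a : Fin n, (RBN.mean (RBN.prodWeight (Fin n × Bool) (RBN.entryWeight n D T))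
          (RBN.networkSensitivity t a) - RBN.networkInfluence Kmax D T ^ t)| := by
        rw [Finset.sum_sub_distrib]
        simp
    _ ≤ ∑ _a : Fin n, ((Kmax : ℝ) ^ t) ^ 3 / n := (Finset.abs_sum_le_sum_abs _ _).trans
        (Finset.sum_le_sum fun a _ => RBN.abs_mean_networkSensitivity_sub_le hK hKn hD hT t a)
    _ = _ := by
        simp
        ring
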